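/- **Setting.** Let $p,q$ be nonzero complex numbers such that $pq$ is not a root of unity (generic parameters). Fix logarithms (principal branch), so that $q^x,p^x$ make sense, put $(q/p)^x:=q^xp^{-x}$, $[x]=\dfrac{q^x-p^{-x}}{q-p^{-1}}$ and $[X,Y]_r=XY-rYX$, and fix for every $x$ a square root $[x]^{1/2}$; then $([a][b])^{1/2}:=[a]^{1/2}[b]^{1/2}$ and $([a]/[b])^{1/2}:=[a]^{1/2}/[b]^{1/2}$. $U=U_{p,q}[gl(2/1)]$ is the associative algebra generated by $E_{11},E_{22},E_{33},L$ (and the exponentials of their linear combinations), $E_{12},E_{21},E_{23},E_{32}$, with $h_1=E_{11}-E_{22}$, $h_2=E_{22}+E_{33}$ and relations: $E_{ii}$ and $L$ commute; $[E_{ii},E_{j,j+1}]=(\delta_{ij}-\delta_{i,j+1})E_{j,j+1}$, $[E_{ii},E_{j+1,j}]=(\delta_{i,j+1}-\delta_{ij})E_{j+1,j}$; $[L,E_{12}]=[L,E_{21}]=0$, $[L,E_{23}]=-\frac12E_{23}$, $[L,E_{32}]=\frac12E_{32}$; $[E_{12},E_{21}]=(q/p)^{L-h_1/2}[h_1]$,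 $\{E_{23},E_{32}\}=(q/p)^{-h_2}[h_2]$, $[E_{12},E_{32}]=[E_{21},E_{23}]=0$; $E_{23}^2=E_{32}^2=0$, $[E_{12},E_{13}]_p=[E_{21},E_{31}]_q=0$, where $E_{13}=[E_{12},E_{23}]_{q^{-1}}$, $E_{31}=-[E_{21},E_{32}]_{p^{-1}}$. Let $m_{13},m_{23},m_{33}\in\mathbb C$ with $2l:=m_{13}-m_{23}\in\mathbb Z_{\ge0}$, and let $a_1,a_2,a_3\in\mathbb C\setminus\{0\}$. Put $l_{1j}=m_{1j}-1$, $l_{2j}=m_{2j}-2$, $l_{3j}=m_{3j}-1$. For $k=0,1,2,3$ let $[m_{12},m_{22},m_{31}]$ be $[m_{13},m_{23},m_{33}]$, $[m_{13},m_{23}-1,m_{33}+1]$, $[m_{13}-1,m_{23},m_{33}+1]$, $[m_{13}-1,m_{23}-1,m_{33}+2]$ respectively, and let $V_k$ be the vector space with basis $(m)_k$ indexed by the numbers $m_{11}$ with $m_{12}-m_{11},\,m_{11}-m_{22}\in\mathbb Z_{\ge0}$. Write $(m)=(m)_0$; $(m)_k^{\pm11}$ is $(m)_k$ with $m_{11}$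 replaced by $m_{11}\pm1$; symbols outside the range mean $0$. The induced module $W([m])$ is $(U\otimes V_0)/I$, where $I$ is spanned by all $ub\otimes v-u\otimes bv$, with $u\in U$, $v\in V_0$, and $b$ in the subalgebra generated by all generators but $E_{32}$; the even generators act on $V_0$ by (A) with $k=0$, and $E_{23}V_0=0$. **Proposition.** (i) $W([m])$ is finite-dimensional and isomorphic to $V_0\oplus V_1\oplus V_2\oplus V_3$, with $1\otimes v\mapsto v$ for $v\in V_0$, where $U$ acts in the basis $(m)_k$ as follows. (A) Even generators: with $\varepsilon_k=0,0,1,1$, $t_k=1,1,q/p,1$, $t_k'=1,1,1,q/p$ for $k=0,1,2,3$, $$E_{11}(m)_k=(l_{11}+1)(m)_k,\quad E_{22}(m)_k=(l_{12}+l_{22}-l_{11}+2)(m)_k,\quad E_{33}(m)_k=(l_{31}+1)(m)_k,$$ $$L(m)_k=\left(\tfrac12(l_{12}-l_{22}-1)+\varepsilon_k\right)(m)_k,$$ $$E_{12}(m)_k=t_k\left([l_{12}-l_{11}][l_{11}-l_{22}]\right)^{1/2}(m)_k^{+11},$$ $$E_{21}(m)_k=t'_k\left([l_{12}-l_{11}+1][l_{11}-l_{22}-1]\right)^{1/2}(m)_k^{-11},$$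 exponentials of the diagonal generators acting accordingly. (B) Odd generators: $E_{23}(m)=0$, $$E_{23}(m)_1=a_1\left(\tfrac pq\right)^{l_{23}+l_{33}+3}\left(\tfrac{[l_{11}-l_{23}]}{[2l+1]}\right)^{1/2}[l_{23}+l_{33}+3]\,(m),$$ $$E_{23}(m)_2=a_2\left(\tfrac pq\right)^{l_{23}+l_{33}+4}\left(\tfrac{[l_{13}-l_{11}]}{[2l]}\right)^{1/2}[l_{13}+l_{33}+3]\,(m),$$ $$E_{23}(m)_3=a_3\left(\tfrac pq\right)^{l_{13}+l_{23}+l_{33}-l_{11}+2}\left\{\tfrac1{a_1q}\left(\tfrac{[l_{13}-l_{11}]}{[2l+1]}\right)^{1/2}[l_{13}+l_{33}+3](m)_1-\tfrac1{a_2p}\left([l_{11}-l_{23}][2l]\right)^{1/2}\tfrac{[l_{23}+l_{33}+3]}{[2l+1]}(m)_2\right\},$$ $$E_{32}(m)=\tfrac1{a_1}\left(\tfrac{[l_{11}-l_{23}]}{[2l+1]}\right)^{1/2}(m)_1+\tfrac1{a_2}\left(\tfrac pq\right)^{l_{13}-l_{11}-1}\tfrac{([l_{13}-l_{11}][2l])^{1/2}}{[2l+1]}(m)_2,$$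 $$E_{32}(m)_1=\tfrac{a_1}{a_3}p\left(\tfrac{[l_{13}-l_{11}]}{[2l+1]}\right)^{1/2}(m)_3,\quad E_{32}(m)_2=-\tfrac{a_2}{a_3}p\left(\tfrac qp\right)^{l_{13}-l_{11}-1}\left(\tfrac{[l_{11}-l_{23}]}{[2l]}\right)^{1/2}(m)_3,\quad E_{32}(m)_3=0.$$ (ii) $W([m])$ is irreducible (and then called typical) if and only if $[l_{13}+l_{33}+3]\,[l_{23}+l_{33}+3]\neq0$. (iii) The same criterion holds for the family of operators given by (A), (B) with $\varepsilon_k=0$ and $t_k=t_k'=1$ for all $k$: it has no invariant subspace other than $0$ and the whole space if and only if $[l_{13}+l_{33}+3]\,[l_{23}+l_{33}+3]\neq0$. -/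

import Mathlib

open scoped TensorProduct

noncomputable section

namespace UpqGl21

/-! ### Deformed numbers -/

/-- `(q/p)^x`, understood as `q^x * p^(-x)` with the same branches of the powers of `p` and `q`
as everywhere else. -/
def ratio (p q x : ℂ) : ℂ := q ^ x * p ^ (-x)

/-- The two-parametric deformed number `[x] = (q^x - p^(-x)) / (q - p^(-1))`. -/
def br (p q x : ℂ) : ℂ := (q ^ x - p ^ (-x)) / (q - p⁻¹)

/-! ### The algebra -/

/-- Generators: the Cartan elements `E11, E22, E33`, the element `L`, the exponentials
`expo c = exp (c 0 * E11 + c 1 * E22 + c 2 * E33 + c 3 * L)` (they are what is needed to make sense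
of `q^h`, `p^h` for linear combinations `h` of the Cartan elements and `L`), and the
root generators. -/
inductive Gen : Type
  | H (i : Fin 4)
  | expo (c : Fin 4 → ℂ)
  | E12
  | E21
  | E23
  | E32

/-- The free algebra on the generators. -/
abbrev Free : Type := FreeAlgebra ℂ Gen

/-- A generator as an element of the free algebra. -/
abbrev fg (g : Gen) : Free := FreeAlgebra.ι ℂ g

/-- The linear form `h1 = E11 - E22`. -/
def h1 : Fin 4 → ℂ := ![1, -1, 0, 0]

/-- The linear form `h2 = E22 + E33`. -/
def h2 : Fin 4 → ℂ := ![0, 1, 1, 0]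

/-- The linear form `L`. -/
def formL : Fin 4 → ℂ := ![0, 0, 0, 1]

/-- The operator `q^h` for a linear combination `h` of `E11, E22, E33, L`. -/
def opPow (q : ℂ) (h : Fin 4 → ℂ) : Free := fg (Gen.expo (Complex.log q • h))

/-- The operator `(q/p)^h`. -/
def opRatio (p q : ℂ) (h : Fin 4 → ℂ) : Free := opPow q h * opPow p (-h)

/-- The operator `[h] = (q^h - p^(-h)) / (q - p^(-1))`. -/
def opBr (p q : ℂ) (h : Fin 4 → ℂ) : Free := (q - p⁻¹)⁻¹ • (opPow q h - opPow p (-h))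

/-- The deformed commutator `[X, Y]_r = X Y - r Y X`. -/
def dcomm (r : ℂ) (X Y : Free) : Free := X * Y - r • (Y * X)

/-- `E13 = [E12, E23]_{1/q}`. -/
def E13 (q : ℂ) : Free := dcomm q⁻¹ (fg .E12) (fg .E23)

/-- `E31 = -[E21, E32]_{1/p}`. -/
def E31 (p : ℂ) : Free := -dcomm p⁻¹ (fg .E21) (fg .E32)

/-- The weights of the root generators: the commutators with `E11, E22, E33, L`.
The generators of the Cartan part have weight zero. -/
def root : Gen → Fin 4 → ℂ
  | .H _ => 0
  | .expo _ => 0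
  | .E12 => ![1, -1, 0, 0]
  | .E21 => ![-1, 1, 0, 0]
  | .E23 => ![0, 1, -1, -(1 / 2)]
  | .E32 => ![0, -1, 1, 1 / 2]

/-- The defining relations. -/
inductive Rel (p q : ℂ) : Free → Free → Prop
  /-- `E11, E22, E33, L` act on every generator through its weight; in particular they commute
  with one another, and `L` commutes with `E12` and `E21`. -/
  | cartan (i : Fin 4) (g : Gen) :
      Rel p q (dcomm 1 (fg (.H i)) (fg g)) (root g i • fg g)
  | expo_zero : Rel p q (fg (.expo 0)) 1
  | expo_add (c d : Fin 4 → ℂ) :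
      Rel p q (fg (.expo (c + d))) (fg (.expo c) * fg (.expo d))
  | expo_comm (c : Fin 4 → ℂ) (g : Gen) :
      Rel p q (fg (.expo c) * fg g) (Complex.exp (∑ i, c i * root g i) • (fg g * fg (.expo c)))
  | e12_e21 : Rel p q (dcomm 1 (fg .E12) (fg .E21))
      (opRatio p q (formL - (1 / 2 : ℂ) • h1) * opBr p q h1)
  | e23_e32 : Rel p q (fg .E23 * fg .E32 + fg .E32 * fg .E23)
      (opRatio p q (-h2) * opBr p q h2)
  | e12_e32 : Rel p q (dcomm 1 (fg .E12) (fg .E32)) 0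
  | e21_e23 : Rel p q (dcomm 1 (fg .E21) (fg .E23)) 0
  | e23_sq : Rel p q (fg .E23 * fg .E23) 0
  | e32_sq : Rel p q (fg .E32 * fg .E32) 0
  | serre_plus : Rel p q (dcomm p (fg .E12) (E13 q)) 0
  | serre_minus : Rel p q (dcomm q (fg .E21) (E31 p)) 0

/-- The quantum superalgebra `U_{p,q}[gl(2/1)]`. -/
def U (p q : ℂ) : Type := RingQuot (Rel p q)

instance (p q : ℂ) : Ring (U p q) := inferInstanceAs (Ring (RingQuot (Rel p q)))

instance (p q : ℂ) : Algebra ℂ (U p q) := inferInstanceAs (Algebra ℂ (RingQuot (Rel p q)))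

/-- The quotient map from the free algebra. -/
def proj (p q : ℂ) : Free →ₐ[ℂ] U p q := RingQuot.mkAlgHom ℂ (Rel p q)

/-- The generators, in `U_{p,q}[gl(2/1)]`. -/
def gen (p q : ℂ) (g : Gen) : U p q := proj p q (fg g)

/-! ### Gel'fand-Zetlin modules of the even subalgebra -/

/-- The Gel'fand-Zetlin patterns with first row `m12, m22`: the complex numbers `m11` such that
`m12 - m11` and `m11 - m22` are nonnegative integers. -/
abbrev GZ (m12 m22 : ℂ) : Type :=
  {m11 : ℂ // (∃ a : ℕ, m12 - m11 = a) ∧ ∃ b : ℕ, m11 - m22 = b}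

open Classical in
/-- The basis vector with second row `m11`; it is zero when `m11` does not give a pattern. -/
def gzVec (m12 m22 m11 : ℂ) : GZ m12 m22 →₀ ℂ :=
  if h : (∃ a : ℕ, m12 - m11 = a) ∧ ∃ b : ℕ, m11 - m22 = b then
    Finsupp.single ⟨m11, h⟩ 1 else 0

/-- The eigenvalues of `E11, E22, E33, L` on a pattern, with a shift `ε` of the
eigenvalue of `L`. -/
def gzWeight (m12 m22 m31 ε m11 : ℂ) : Fin 4 → ℂ :=
  let l11 := m11 - 1
  let l12 := m12 - 1
  let l22 := m22 - 2
  let l31 := m31 - 1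
  ![l11 + 1, l12 + l22 - l11 + 2, l31 + 1, (l12 - l22 - 1) / 2 + ε]

/-- The image of the pattern `m11` under a generator. Here `s x` is the chosen square root
of `[x]`. The standard action of the even generators is the one with `ε = 0`, `t = t' = 1`;
the odd generators are sent to `0` here. -/
def gzImage (s : ℂ → ℂ) (m12 m22 m31 ε t t' : ℂ) (m11 : ℂ) : Gen → (GZ m12 m22 →₀ ℂ) :=
  let l11 := m11 - 1
  let l12 := m12 - 1
  let l22 := m22 - 2
  fun g => match g with
  | .H i => gzWeight m12 m22 m31 ε m11 i • gzVec m12 m22 m11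
  | .expo c => Complex.exp (∑ i, c i * gzWeight m12 m22 m31 ε m11 i) • gzVec m12 m22 m11
  | .E12 => (t * (s (l12 - l11) * s (l11 - l22))) • gzVec m12 m22 (m11 + 1)
  | .E21 => (t' * (s (l12 - l11 + 1) * s (l11 - l22 - 1))) • gzVec m12 m22 (m11 - 1)
  | .E23 => 0
  | .E32 => 0

/-! ### The induced module -/

/-- The space `V_0` with signature `m13, m23, m33`. -/
abbrev V0 (m13 m23 : ℂ) : Type := GZ m13 m23 →₀ ℂ

/-- The action on `V_0` of the even generators, and of `E23` by zero. -/
def V0op (s : ℂ → ℂ) (m13 m23 m33 : ℂ) (g : Gen) : V0 m13 m23 →ₗ[ℂ] V0 m13 m23 :=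
  Finsupp.linearCombination ℂ fun m : GZ m13 m23 => gzImage s m13 m23 m33 0 1 1 m.1 g

/-- The subspace of `U ⊗ V_0` spanned by all `u b ⊗ v - u ⊗ b v` with `u` in `U`, `v` in `V_0`
and `b` one of the generators of `U(B)`, that is any generator but `E32`. The case of
an arbitrary `b` in `U(B)` follows. -/
def inducedRel (p q : ℂ) (s : ℂ → ℂ) (m13 m23 m33 : ℂ) :
    Submodule (U p q) (U p q ⊗[ℂ] V0 m13 m23) :=
  Submodule.span (U p q) {t | ∃ (u : U p q) (b : Gen) (v : V0 m13 m23), b ≠ Gen.E32 ∧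
    t = (u * gen p q b) ⊗ₜ[ℂ] v - u ⊗ₜ[ℂ] V0op s m13 m23 m33 b v}

/-- The induced module `(U ⊗ V_0) / I`. -/
abbrev Induced (p q : ℂ) (s : ℂ → ℂ) (m13 m23 m33 : ℂ) : Type :=
  (U p q ⊗[ℂ] V0 m13 m23) ⧸ inducedRel p q s m13 m23 m33

/-- The class of `u ⊗ v` in the induced module. -/
def Induced.mk (p q : ℂ) (s : ℂ → ℂ) (m13 m23 m33 : ℂ) (u : U p q) (v : V0 m13 m23) :
    Induced p q s m13 m23 m33 :=
  (inducedRel p q s m13 m23 m33).mkQ (u ⊗ₜ[ℂ] v)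

/-! ### The reduced basis and the explicit operators -/

/-- `m12` in the `k`-th component. -/
def row12 (m13 : ℂ) : Fin 4 → ℂ := ![m13, m13, m13 - 1, m13 - 1]

/-- `m22` in the `k`-th component. -/
def row22 (m23 : ℂ) : Fin 4 → ℂ := ![m23, m23 - 1, m23, m23 - 1]

/-- `m31 = m32` in the `k`-th component. -/
def row31 (m33 : ℂ) : Fin 4 → ℂ := ![m33, m33 + 1, m33 + 1, m33 + 2]

/-- The index set of the reduced basis. -/
abbrev Pattern (m13 m23 : ℂ) : Type := Σ k : Fin 4, GZ (row12 m13 k) (row22 m23 k)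

/-- The space with the reduced basis, the direct sum of the four components `V_k`. -/
abbrev W (m13 m23 : ℂ) : Type := Pattern m13 m23 →₀ ℂ

/-- The inclusion of the component `V_k`. -/
def emb (m13 m23 : ℂ) (k : Fin 4) :
    (GZ (row12 m13 k) (row22 m23 k) →₀ ℂ) →ₗ[ℂ] W m13 m23 :=
  Finsupp.lmapDomain ℂ ℂ fun x => (⟨k, x⟩ : Pattern m13 m23)

/-- The reduced basis vector `(m)_k` with last row entry `m11`; it is zero when there is no
such pattern. -/
def vec (m13 m23 : ℂ) (k : Fin 4) (m11 : ℂ) : W m13 m23 :=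
  emb m13 m23 k (gzVec (row12 m13 k) (row22 m23 k) m11)

/-- The image of the reduced basis vector `(m)_k` under `E23`. -/
def image23 (p q : ℂ) (s : ℂ → ℂ) (a1 a2 a3 m13 m23 m33 : ℂ) (k : Fin 4) (m11 : ℂ) :
    W m13 m23 :=
  let l11 := m11 - 1
  let l13 := m13 - 1
  let l23 := m23 - 2
  let l33 := m33 - 1
  let l := (m13 - m23) / 2
  ![0,
    (a1 * ratio q p (l23 + l33 + 3) * (s (l11 - l23) / s (2 * l + 1)) *
      br p q (l23 + l33 + 3)) • vec m13 m23 0 m11,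
    (a2 * ratio q p (l23 + l33 + 4) * (s (l13 - l11) / s (2 * l)) *
      br p q (l13 + l33 + 3)) • vec m13 m23 0 m11,
    (a3 * ratio q p (l13 + l23 + l33 - l11 + 2)) •
      ((1 / (a1 * q) * (s (l13 - l11) / s (2 * l + 1)) * br p q (l13 + l33 + 3)) •
          vec m13 m23 1 m11
        - (1 / (a2 * p) * (s (l11 - l23) * s (2 * l)) *
            (br p q (l23 + l33 + 3) / br p q (2 * l + 1))) • vec m13 m23 2 m11)] k

/-- The image of the reduced basis vector `(m)_k` under `E32`. -/
def image32 (p q : ℂ) (s : ℂ → ℂ) (a1 a2 a3 m13 m23 : ℂ) (k : Fin 4) (m11 : ℂ) :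
    W m13 m23 :=
  let l11 := m11 - 1
  let l13 := m13 - 1
  let l23 := m23 - 2
  let l := (m13 - m23) / 2
  ![(1 / a1 * (s (l11 - l23) / s (2 * l + 1))) • vec m13 m23 1 m11
      + (1 / a2 * ratio q p (l13 - l11 - 1) *
          ((s (l13 - l11) * s (2 * l)) / br p q (2 * l + 1))) • vec m13 m23 2 m11,
    (a1 / a3 * p * (s (l13 - l11) / s (2 * l + 1))) • vec m13 m23 3 m11,
    (-(a2 / a3) * p * ratio p q (l13 - l11 - 1) * (s (l11 - l23) / s (2 * l))) •
      vec m13 m23 3 m11,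
    0] k

/-- The image of the reduced basis vector `(m)_k` under a generator. The even generators act
inside `V_k`, the component `V_2` carrying a factor `τ` in `E12`, the component `V_3` a factor `τ`
in `E21`, and both a shift `ε` of `L`. -/
def image (p q : ℂ) (s : ℂ → ℂ) (a1 a2 a3 τ ε m13 m23 m33 : ℂ) (k : Fin 4) (m11 : ℂ) :
    Gen → W m13 m23
  | .E23 => image23 p q s a1 a2 a3 m13 m23 m33 k m11
  | .E32 => image32 p q s a1 a2 a3 m13 m23 k m11
  | g => emb m13 m23 k (gzImage s (row12 m13 k) (row22 m23 k) (row31 m33 k)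
      (![0, 0, ε, ε] k) (![1, 1, τ, 1] k) (![1, 1, 1, τ] k) m11 g)

/-- The operators on `W` with the matrix elements given by `image`. -/
def redOp (p q : ℂ) (s : ℂ → ℂ) (a1 a2 a3 τ ε m13 m23 m33 : ℂ) (g : Gen) :
    W m13 m23 →ₗ[ℂ] W m13 m23 :=
  Finsupp.linearCombination ℂ fun m : Pattern m13 m23 =>
    image p q s a1 a2 a3 τ ε m13 m23 m33 m.1 m.2.1 g

/-- A family of operators on a space is irreducible: the space is nonzero and has no
invariant subspace besides `0` and itself. -/
def IrreducibleFamily {X : Type*} [AddCommGroup X] [Module ℂ X] (op : Gen → X →ₗ[ℂ] X) : Prop :=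
  Nontrivial X ∧ ∀ S : Submodule ℂ X, (∀ g, ∀ x ∈ S, op g x ∈ S) → S = ⊥ ∨ S = ⊤

end UpqGl21

end

noncomputable section

namespace UpqGl21

/-! ### Deformed numbers at integers -/

section Numbers

variable {p q : ℂ}

/-! Write N = m13 - m23 and m11 = m13 - a. The patterns of the four components then become integer
intervals for a, namely [0, N], [0, N+1], [1, N], [1, N+1], and every matrix element is a function
of the integer a.

The operators form a representation because, on basis vectors, each non-Cartan relation is either a
plain cancellation or one of three identities for deformed numbers: `br_commutator` for [E12, E21],
`br_anticommutator` for {E23, E32}, and the three-term recurrence `br_recurrence` for the Serre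
relations. The chosen roots s need no compatibility beyond s x ^ 2 = [x]. The relations involving
the Cartan part say that each generator shifts weights by its root. `freeRep_rel` collects these
checks.

The representation induces a map u ⊗ v ↦ ρ(u) v from the induced module to W. It is onto because V_0
generates W (`eq_top_of_bv_zero_mem`). It is injective by counting: reordering products in the
algebra (`gen_mul_frame_mem`) shows that 1, E32, E31, E32 E31 applied to V_0 span the induced
module, so its dimension is at most 4(N+1), which is the dimension of W. The reordering rests on
E31² = 0 (`e31_mul_e31`), a consequence of the Serre relation and E32² = 0. No PBW theorem is
needed, since independence of the four products is a by-product of the count.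

For irreducibility put X = [m23 + m33] and Y = [m23 + m33 + N + 1]. The raising operator E23 goes
V_1 → V_0 and V_3 → V_2 with a factor X, and V_2 → V_0 and V_3 → V_1 with a factor Y. If Y = 0 then
V_2 + V_3 is invariant; if X = 0 then V_1 + V_3 is. If both are nonzero, a nonzero invariant
subspace contains a weight vector, which the generators carry back into V_0, and V_0 generates
everything (`eq_top_of_ne_bot`). This argument uses only which matrix elements vanish, so it covers
the operators with and without the factors q/p and the shift of L (`irreducibleFamily_iff`). -/

lemma sub_inv_ne_zero (hp : p ≠ 0) (hgen : ∀ n : ℕ, 0 < n → (p * q) ^ n ≠ 1) :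
    q - p⁻¹ ≠ 0 := by
  intro h
  apply hgen 1 one_pos
  rw [sub_eq_zero] at h
  rw [h]; field_simp

lemma inv_add_ne_zero (hp : p ≠ 0) (hgen : ∀ n : ℕ, 0 < n → (p * q) ^ n ≠ 1) :
    p⁻¹ + q ≠ 0 := by
  intro h
  apply hgen 2 two_pos
  have : q = -p⁻¹ := by linear_combination h
  rw [this]; field_simp

lemma br_zero : br p q 0 = 0 := by simp [br]

lemma br_intCast (n : ℤ) : br p q n = (q ^ n - (p ^ n)⁻¹) / (q - p⁻¹) := by
  simp [br, ← Int.cast_neg, Complex.cpow_intCast]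

lemma ratio_add (hp : p ≠ 0) (hq : q ≠ 0) (x y : ℂ) :
    ratio p q (x + y) = ratio p q x * ratio p q y := by
  simp only [ratio, neg_add, Complex.cpow_add _ _ hp, Complex.cpow_add _ _ hq]; ring

lemma ratio_ne_zero (hp : p ≠ 0) (hq : q ≠ 0) (x : ℂ) : ratio p q x ≠ 0 := by
  simp [ratio, Complex.cpow_eq_zero_iff, hp, hq]

lemma ratio_intCast (n : ℤ) : ratio p q n = (q / p) ^ n := by
  simp [ratio, ← Int.cast_neg, Complex.cpow_intCast, div_eq_mul_inv, mul_zpow]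

lemma mul_zpow_ne_one (hgen : ∀ n : ℕ, 0 < n → (p * q) ^ n ≠ 1) {n : ℤ} (hn : n ≠ 0) : (p * q) ^ n ≠ 1 := by
  intro h
  rcases lt_or_gt_of_ne hn with hn | hn
  · obtain ⟨k, rfl⟩ := Int.exists_eq_neg_ofNat hn.le
    refine hgen k (by omega) ?_
    simpa using h
  · obtain ⟨k, rfl⟩ := Int.eq_ofNat_of_zero_le hn.le
    exact hgen k (by omega) (by simpa using h)

/-- Vanishing would mean q^n = p^(-n), hence (pq)^n = 1. This is the main use of genericity: square
roots of nonzero integer brackets may be cancelled. -/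
lemma br_intCast_ne_zero (hp : p ≠ 0)
    (hgen : ∀ n : ℕ, 0 < n → (p * q) ^ n ≠ 1) {n : ℤ} (hn : n ≠ 0) : br p q n ≠ 0 := by
  rw [br_intCast]
  refine div_ne_zero ?_ (sub_inv_ne_zero hp hgen)
  intro h
  apply mul_zpow_ne_one hgen hn
  rw [mul_zpow, sub_eq_zero.1 h]
  exact mul_inv_cancel₀ (zpow_ne_zero _ hp)

/-- The three-term recurrence for deformed numbers. -/
lemma br_recurrence (hp : p ≠ 0) (hq : q ≠ 0) (y : ℂ) :
    br p q (y + 1) - (q + p⁻¹) * br p q y + q / p * br p q (y - 1) = 0 := by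
  simp only [br, sub_eq_add_neg, neg_add, Complex.cpow_add _ _ hp, Complex.cpow_add _ _ hq,
    Complex.cpow_neg, Complex.cpow_one, inv_inv]
  field_simp
  ring

/-- The commutator identity for deformed numbers. -/
lemma br_commutator (hp : p ≠ 0) (hq : q ≠ 0) (hgen : ∀ n : ℕ, 0 < n → (p * q) ^ n ≠ 1)
    (x y : ℂ) : br p q (x + 1) * br p q y - br p q x * br p q (y + 1) =
      ratio p q x * br p q (y - x) := by
  have h := sub_inv_ne_zero hp hgen
  have hP : ∀ z : ℂ, p ^ z ≠ 0 := fun z => by simp [Complex.cpow_eq_zero_iff, hp]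
  have hQ : ∀ z : ℂ, q ^ z ≠ 0 := fun z => by simp [Complex.cpow_eq_zero_iff, hq]
  have hP1 := hP x; have hP2 := hP y; have hQ1 := hQ x; have hQ2 := hQ y
  simp only [br, ratio, sub_eq_add_neg y, neg_add, Complex.cpow_add _ _ hp,
    Complex.cpow_add _ _ hq, Complex.cpow_neg, Complex.cpow_one, inv_inv]
  -- Once exponents are split additively, the powers are independent nonzero unknowns and the claim
  -- is an identity of rational functions.
  generalize p ^ x = A at *
  generalize p ^ y = B at *
  generalize q ^ x = C at *
  generalize q ^ y = D at *
  rw [div_mul_div_comm, div_mul_div_comm, ← sub_div, mul_div_assoc',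
    div_eq_div_iff (mul_ne_zero h h) h]
  field_simp
  ring

/-- The anticommutator identity for deformed numbers. -/
lemma br_anticommutator (hp : p ≠ 0) (hq : q ≠ 0) (hgen : ∀ n : ℕ, 0 < n → (p * q) ^ n ≠ 1)
    (x y z : ℂ) : br p q y * br p q x + ratio q p z * (br p q z * br p q (x + (y + z))) =
      br p q (y + z) * (ratio q p z * br p q (x + z)) := by
  have h := sub_inv_ne_zero hp hgen
  have hP : ∀ z : ℂ, p ^ z ≠ 0 := fun z => by simp [Complex.cpow_eq_zero_iff, hp]
  have hQ : ∀ z : ℂ, q ^ z ≠ 0 := fun z => by simp [Complex.cpow_eq_zero_iff, hq]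
  have hP1 := hP x; have hP2 := hP y; have hQ1 := hQ x; have hQ2 := hQ y
  have hP3 := hP z; have hQ3 := hQ z
  simp only [br, ratio, neg_add, Complex.cpow_add _ _ hp,
    Complex.cpow_add _ _ hq, Complex.cpow_neg]
  generalize p ^ x = A at *
  generalize p ^ y = B at *
  generalize q ^ x = C at *
  generalize q ^ y = D at *
  generalize p ^ z = E at *
  generalize q ^ z = F at *
  have h' : p * q - 1 ≠ 0 := by
    intro h1; apply h; field_simp; linear_combination h1
  have : q - p⁻¹ = (p * q - 1) / p := by field_simp
  rw [this]
  field_simp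
  ring

end Numbers

/-! ### The reduced basis, indexed by integers -/

/-- The vector `(m)_k` with last row entry `m13 - a`. -/
def bv (m13 m23 : ℂ) (k : Fin 4) (a : ℤ) : W m13 m23 := vec m13 m23 k (m13 - a)

/-- The smallest value of `m13 - m11` in the `k`-th component. -/
def lo : Fin 4 → ℤ := ![0, 0, 1, 1]

/-- The largest value of `m13 - m11` in the `k`-th component. -/
def hi (N : ℤ) : Fin 4 → ℤ := ![N, N + 1, N, N + 1]

section Basis

variable {m13 m23 : ℂ} {N : ℕ}

lemma row12_eq (m13 : ℂ) (k : Fin 4) : row12 m13 k = m13 - lo k := by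
  fin_cases k <;> simp [row12, lo]

lemma row22_eq (hN : m13 - m23 = N) (k : Fin 4) : row22 m23 k = m13 - hi N k := by
  have : m13 = m23 + N := by linear_combination hN
  subst this
  fin_cases k <;> simp [row22, hi] <;> ring

/-- The two conditions on complex numbers become membership in an integer interval, after which
range questions are settled by `omega`. -/
lemma isPattern_iff (hN : m13 - m23 = N) (k : Fin 4) (a : ℤ) :
    ((∃ c : ℕ, row12 m13 k - (m13 - a) = c) ∧ ∃ b : ℕ, m13 - a - row22 m23 k = b) ↔
      lo k ≤ a ∧ a ≤ hi N k := by
  rw [row12_eq, row22_eq hN]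
  have h1 : m13 - lo k - (m13 - a) = ((a - lo k : ℤ) : ℂ) := by push_cast; ring
  have h2 : m13 - a - (m13 - hi N k) = ((hi N k - a : ℤ) : ℂ) := by push_cast; ring
  rw [h1, h2]
  constructor
  · rintro ⟨⟨c, hc⟩, ⟨b, hb⟩⟩
    have hc' : a - lo k = c := by exact_mod_cast hc
    have hb' : hi N k - a = b := by exact_mod_cast hb
    omega
  · rintro ⟨h, h'⟩
    refine ⟨⟨(a - lo k).toNat, ?_⟩, ⟨(hi N k - a).toNat, ?_⟩⟩
    · have : ((a - lo k).toNat : ℤ) = a - lo k := Int.toNat_of_nonneg (by omega)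
      exact_mod_cast this.symm
    · have : ((hi N k - a).toNat : ℤ) = hi N k - a := Int.toNat_of_nonneg (by omega)
      exact_mod_cast this.symm

lemma emb_single (k : Fin 4) (x : GZ (row12 m13 k) (row22 m23 k)) (c : ℂ) :
    emb m13 m23 k (Finsupp.single x c) = Finsupp.single ⟨k, x⟩ c := by
  simp [emb, Finsupp.lmapDomain_apply]

lemma bv_eq_zero (hN : m13 - m23 = N) {k : Fin 4} {a : ℤ} (h : ¬ (lo k ≤ a ∧ a ≤ hi N k)) :
    bv m13 m23 k a = 0 := by
  rw [← isPattern_iff hN] at h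
  simp only [bv, vec, gzVec, dif_neg h, map_zero]

lemma bv_eq_single (hN : m13 - m23 = N) {k : Fin 4} {a : ℤ} (h : lo k ≤ a ∧ a ≤ hi N k) :
    bv m13 m23 k a = Finsupp.single ⟨k, ⟨m13 - a, (isPattern_iff hN k a).2 h⟩⟩ 1 := by
  have h' := (isPattern_iff hN k a).2 h
  simp only [bv, vec, gzVec, dif_pos h', emb_single]

lemma exists_eq_bv (hN : m13 - m23 = N) (m : Pattern m13 m23) :
    ∃ a : ℤ, (lo m.1 ≤ a ∧ a ≤ hi N m.1) ∧ m.2.1 = m13 - a ∧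
      Finsupp.single m (1 : ℂ) = bv m13 m23 m.1 a := by
  obtain ⟨k, m11, hm⟩ := m
  obtain ⟨c, hc⟩ := hm.1
  have ha : m11 = m13 - ((c + lo k : ℤ) : ℂ) := by
    rw [row12_eq] at hc; push_cast; linear_combination -hc
  subst ha
  have hr := (isPattern_iff hN k _).1 hm
  exact ⟨_, hr, rfl, (bv_eq_single hN hr).symm⟩

lemma span_bv (hN : m13 - m23 = N) (S : Submodule ℂ (W m13 m23))
    (h : ∀ k a, lo k ≤ a → a ≤ hi N k → bv m13 m23 k a ∈ S) : S = ⊤ := by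
  rw [eq_top_iff]
  rintro x -
  induction x using Finsupp.induction_linear with
  | zero => exact S.zero_mem
  | add f g hf hg => exact S.add_mem hf hg
  | single m c =>
    obtain ⟨a, ha, -, he⟩ := exists_eq_bv hN m
    have : Finsupp.single m c = c • Finsupp.single m (1 : ℂ) := by simp
    rw [this, he]
    exact S.smul_mem _ (h _ _ ha.1 ha.2)

lemma hom_ext_bv {X : Type*} [AddCommGroup X] [Module ℂ X] (hN : m13 - m23 = N)
    {f g : W m13 m23 →ₗ[ℂ] X}
    (h : ∀ k a, f (bv m13 m23 k a) = g (bv m13 m23 k a)) : f = g := by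
  rw [← LinearMap.eqLocus_eq_top]
  exact span_bv hN _ fun k a _ _ => h k a

end Basis

/-! ### Matrix elements in the integer parameter. -/

section Operators

variable {p q : ℂ} {s : ℂ → ℂ} {a1 a2 a3 τ ε m13 m23 m33 : ℂ} {N : ℕ}

lemma redOp_bv_of_mem (hN : m13 - m23 = N) (g : Gen) {k : Fin 4} {a : ℤ}
    (h : lo k ≤ a ∧ a ≤ hi N k) :
    redOp p q s a1 a2 a3 τ ε m13 m23 m33 g (bv m13 m23 k a) =
      image p q s a1 a2 a3 τ ε m13 m23 m33 k (m13 - a) g := by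
  rw [bv_eq_single hN h]; simp [redOp]

lemma s_zero (hs : ∀ x, s x ^ 2 = br p q x) : s 0 = 0 := by
  have := hs 0
  rw [br_zero] at this
  exact pow_eq_zero_iff two_ne_zero |>.1 this

/-- The eigenvalues of the Cartan generators on the reduced basis. -/
def wt (m13 m23 m33 ε : ℂ) (k : Fin 4) (a : ℤ) : Fin 4 → ℂ :=
  ![m13 - a, m23 + a - ![0, 1, 1, 2] k, m33 + ![0, 1, 1, 2] k,
    (m13 - m23) / 2 + ![0, 1 / 2, -(1 / 2) + ε, ε] k]

lemma gzWeight_eq (k : Fin 4) (a : ℤ) :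
    gzWeight (row12 m13 k) (row22 m23 k) (row31 m33 k) (![0, 0, ε, ε] k) (m13 - a) =
      wt m13 m23 m33 ε k a := by
  funext i
  fin_cases k <;> fin_cases i <;> simp [gzWeight, wt, row12, row22, row31] <;> ring

lemma redOp_H (hN : m13 - m23 = N) (i : Fin 4) (k : Fin 4) (a : ℤ) :
    redOp p q s a1 a2 a3 τ ε m13 m23 m33 (.H i) (bv m13 m23 k a) =
      wt m13 m23 m33 ε k a i • bv m13 m23 k a := by
  by_cases h : lo k ≤ a ∧ a ≤ hi N k
  · rw [redOp_bv_of_mem hN _ h]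
    simp only [image, gzImage, gzWeight_eq, map_smul, bv, vec]
  · simp [bv_eq_zero hN h]

lemma redOp_expo (hN : m13 - m23 = N) (c : Fin 4 → ℂ) (k : Fin 4) (a : ℤ) :
    redOp p q s a1 a2 a3 τ ε m13 m23 m33 (.expo c) (bv m13 m23 k a) =
      Complex.exp (∑ i, c i * wt m13 m23 m33 ε k a i) • bv m13 m23 k a := by
  by_cases h : lo k ≤ a ∧ a ≤ hi N k
  · rw [redOp_bv_of_mem hN _ h]
    simp only [image, gzImage, gzWeight_eq, map_smul, bv, vec]
  · simp [bv_eq_zero hN h]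

/-- The formula holds for every integer a, not only for a in the range of V_k: whenever the source
vector is zero but the target is not, the coefficient contains s 0 = 0. The formulas for the other
root generators have the same feature, so boundary cases can largely be ignored when checking
relations. -/
lemma redOp_E12 (hs : ∀ x, s x ^ 2 = br p q x) (hN : m13 - m23 = N) (k : Fin 4) (a : ℤ) :
    redOp p q s a1 a2 a3 τ ε m13 m23 m33 .E12 (bv m13 m23 k a) =
      (![1, 1, τ, 1] k * (s (a - lo k) * s (hi N k + 1 - a))) • bv m13 m23 k (a - 1) := by
  by_cases h : lo k ≤ a ∧ a ≤ hi N k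
  · rw [redOp_bv_of_mem hN _ h]
    simp only [image, gzImage, map_smul, bv, vec, row12_eq, row22_eq hN]
    rw [show m13 - lo k - 1 - (m13 - a - 1) = a - lo k by ring,
      show m13 - a - 1 - (m13 - hi N k - 2) = hi N k + 1 - a by ring,
      show m13 - ((a - 1 : ℤ) : ℂ) = m13 - a + 1 by push_cast; ring]
  · rw [bv_eq_zero hN h, map_zero]
    by_cases h' : lo k ≤ a - 1 ∧ a - 1 ≤ hi N k
    · have : a = hi N k + 1 := by omega
      simp [this, s_zero hs]
    · rw [bv_eq_zero hN h', smul_zero]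

lemma redOp_E21 (hs : ∀ x, s x ^ 2 = br p q x) (hN : m13 - m23 = N) (k : Fin 4) (a : ℤ) :
    redOp p q s a1 a2 a3 τ ε m13 m23 m33 .E21 (bv m13 m23 k a) =
      (![1, 1, 1, τ] k * (s (a + 1 - lo k) * s (hi N k - a))) • bv m13 m23 k (a + 1) := by
  by_cases h : lo k ≤ a ∧ a ≤ hi N k
  · rw [redOp_bv_of_mem hN _ h]
    simp only [image, gzImage, map_smul, bv, vec, row12_eq, row22_eq hN]
    rw [show m13 - lo k - 1 - (m13 - a - 1) + 1 = a + 1 - lo k by ring,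
      show m13 - a - 1 - (m13 - hi N k - 2) - 1 = hi N k - a by ring,
      show m13 - ((a + 1 : ℤ) : ℂ) = m13 - a - 1 by push_cast; ring]
  · rw [bv_eq_zero hN h, map_zero]
    by_cases h' : lo k ≤ a + 1 ∧ a + 1 ≤ hi N k
    · have : (a : ℂ) + 1 - lo k = 0 := by
        have : a + 1 - lo k = 0 := by omega
        exact_mod_cast this
      simp [this, s_zero hs]
    · rw [bv_eq_zero hN h', smul_zero]

lemma redOp_E23_zero (hN : m13 - m23 = N) (a : ℤ) :
    redOp p q s a1 a2 a3 τ ε m13 m23 m33 .E23 (bv m13 m23 0 a) = 0 := by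
  by_cases h : lo 0 ≤ a ∧ a ≤ hi N 0
  · rw [redOp_bv_of_mem hN _ h]; rfl
  · simp [bv_eq_zero hN h]

lemma redOp_E23_one (hN : m13 - m23 = N) (a : ℤ) :
    redOp p q s a1 a2 a3 τ ε m13 m23 m33 .E23 (bv m13 m23 1 a) =
      (a1 * ratio q p (m23 + m33) * br p q (m23 + m33) * (s (N + 1 - a) / s (N + 1))) •
        bv m13 m23 0 a := by
  by_cases h : lo 1 ≤ a ∧ a ≤ hi N 1
  · rw [redOp_bv_of_mem hN _ h]
    simp only [image, image23, bv, Matrix.cons_val_one, Matrix.cons_val_zero]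
    rw [show m23 - 2 + (m33 - 1) + 3 = m23 + m33 by ring,
      show m13 - a - 1 - (m23 - 2) = N + 1 - a by linear_combination hN,
      show 2 * ((m13 - m23) / 2) + 1 = (N : ℂ) + 1 by linear_combination hN]
    congr 1; ring
  · have h' : ¬ (lo 0 ≤ a ∧ a ≤ hi N 0) := by
      simp [lo, hi] at h ⊢; omega
    simp [bv_eq_zero hN h, bv_eq_zero hN h']

lemma redOp_E23_two (hp : p ≠ 0) (hq : q ≠ 0) (hs : ∀ x, s x ^ 2 = br p q x)
    (hN : m13 - m23 = N) (a : ℤ) :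
    redOp p q s a1 a2 a3 τ ε m13 m23 m33 .E23 (bv m13 m23 2 a) =
      (a2 * ratio q p (m23 + m33) * (p / q) * br p q (m23 + m33 + N + 1) * (s a / s N)) •
        bv m13 m23 0 a := by
  by_cases h : lo 2 ≤ a ∧ a ≤ hi N 2
  · rw [redOp_bv_of_mem hN _ h]
    simp only [image, image23, bv, Matrix.cons_val]
    have hr : ratio q p 1 = p / q := by simpa using ratio_intCast (p := q) (q := p) 1
    rw [show m23 - 2 + (m33 - 1) + 4 = m23 + m33 + 1 by ring,
      show m13 - 1 + (m33 - 1) + 3 = m23 + m33 + N + 1 by linear_combination hN,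
      show m13 - 1 - (m13 - a - 1) = a by ring,
      show 2 * ((m13 - m23) / 2) = (N : ℂ) by linear_combination hN, ratio_add hq hp, hr]
    congr 1; ring
  · rw [bv_eq_zero hN h, map_zero]
    by_cases h' : lo 0 ≤ a ∧ a ≤ hi N 0
    · have : a = 0 := by simp [lo, hi] at h h'; omega
      simp [this, s_zero hs]
    · rw [bv_eq_zero hN h', smul_zero]

lemma redOp_E23_three (hp : p ≠ 0) (hq : q ≠ 0) (hs : ∀ x, s x ^ 2 = br p q x)
    (hN : m13 - m23 = N) (a : ℤ) :
    redOp p q s a1 a2 a3 τ ε m13 m23 m33 .E23 (bv m13 m23 3 a) =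
      (a3 / a1 / p * ratio q p (m23 + m33) * (p / q) ^ a * br p q (m23 + m33 + N + 1) *
        (s a / s (N + 1))) • bv m13 m23 1 a +
      (-(a3 / a2) * q / p ^ 2 * ratio q p (m23 + m33) * (p / q) ^ a * br p q (m23 + m33) *
        (s (N + 1 - a) * s N / br p q (N + 1))) • bv m13 m23 2 a := by
  by_cases h : lo 3 ≤ a ∧ a ≤ hi N 3
  · rw [redOp_bv_of_mem hN _ h]
    simp only [image, image23, bv, Matrix.cons_val]
    have hr : ratio q p (-1) = q / p := by
      simpa using ratio_intCast (p := q) (q := p) (-1)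
    rw [show m23 - 2 + (m33 - 1) + 3 = m23 + m33 by ring,
      show m13 - 1 + (m23 - 2) + (m33 - 1) - (m13 - a - 1) + 2 = m23 + m33 + a + (-1) by ring,
      show m13 - 1 + (m33 - 1) + 3 = m23 + m33 + N + 1 by linear_combination hN,
      show m13 - 1 - (m13 - a - 1) = a by ring,
      show m13 - a - 1 - (m23 - 2) = N + 1 - a by linear_combination hN,
      show 2 * ((m13 - m23) / 2) + 1 = (N : ℂ) + 1 by linear_combination hN,
      show 2 * ((m13 - m23) / 2) = (N : ℂ) by linear_combination hN, ratio_add hq hp, hr,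
      ratio_add hq hp, ratio_intCast, smul_sub, sub_eq_add_neg, smul_smul, smul_smul,
      ← neg_smul]
    congr 2
    · field_simp
    · field_simp
  · have h' : ¬ (lo 2 ≤ a ∧ a ≤ hi N 2) := by
      simp [lo, hi] at h ⊢; omega
    -- Outside the range of V_3 only a = 0 can still index a vector of V_1, and there the factor s a
    -- vanishes.
    rw [bv_eq_zero hN h, bv_eq_zero hN h', map_zero]
    by_cases h' : lo 1 ≤ a ∧ a ≤ hi N 1
    · have : a = 0 := by simp [lo, hi] at h h'; omega
      simp [this, s_zero hs]
    · simp [bv_eq_zero hN h']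

lemma redOp_E32_zero (hp : p ≠ 0) (hq : q ≠ 0) (hs : ∀ x, s x ^ 2 = br p q x)
    (hN : m13 - m23 = N) (a : ℤ) :
    redOp p q s a1 a2 a3 τ ε m13 m23 m33 .E32 (bv m13 m23 0 a) =
      (1 / a1 * (s (N + 1 - a) / s (N + 1))) • bv m13 m23 1 a +
      (1 / a2 * (q / p) * (p / q) ^ a * (s a * s N / br p q (N + 1))) • bv m13 m23 2 a := by
  by_cases h : lo 0 ≤ a ∧ a ≤ hi N 0
  · rw [redOp_bv_of_mem hN _ h]
    simp only [image, image32, bv, Matrix.cons_val]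
    have hr : ratio q p (-1) = q / p := by
      simpa using ratio_intCast (p := q) (q := p) (-1)
    rw [show m13 - 1 - (m13 - a - 1) = a by ring,
      show m13 - a - 1 - (m23 - 2) = N + 1 - a by linear_combination hN,
      show 2 * ((m13 - m23) / 2) + 1 = (N : ℂ) + 1 by linear_combination hN,
      show 2 * ((m13 - m23) / 2) = (N : ℂ) by linear_combination hN, sub_eq_add_neg (a : ℂ) 1,
      ratio_add hq hp, hr, ratio_intCast]
    congr 2; ring
  · have h' : ¬ (lo 2 ≤ a ∧ a ≤ hi N 2) := by
      simp [lo, hi] at h ⊢; omega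
    rw [bv_eq_zero hN h, bv_eq_zero hN h', map_zero]
    by_cases h' : lo 1 ≤ a ∧ a ≤ hi N 1
    · have : a = N + 1 := by simp [lo, hi] at h h'; omega
      simp [this, s_zero hs]
    · simp [bv_eq_zero hN h']

lemma redOp_E32_one (hN : m13 - m23 = N) (a : ℤ) :
    redOp p q s a1 a2 a3 τ ε m13 m23 m33 .E32 (bv m13 m23 1 a) =
      (a1 / a3 * p * (s a / s (N + 1))) • bv m13 m23 3 a := by
  by_cases h : lo 1 ≤ a ∧ a ≤ hi N 1
  · rw [redOp_bv_of_mem hN _ h]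
    simp only [image, image32, bv, Matrix.cons_val]
    rw [show m13 - 1 - (m13 - a - 1) = a by ring,
      show 2 * ((m13 - m23) / 2) + 1 = (N : ℂ) + 1 by linear_combination hN]
  · have h' : ¬ (lo 3 ≤ a ∧ a ≤ hi N 3) := by
      simp [lo, hi] at h ⊢; omega
    simp [bv_eq_zero hN h, bv_eq_zero hN h']

lemma redOp_E32_two (hp : p ≠ 0) (hq : q ≠ 0) (hs : ∀ x, s x ^ 2 = br p q x)
    (hN : m13 - m23 = N) (a : ℤ) :
    redOp p q s a1 a2 a3 τ ε m13 m23 m33 .E32 (bv m13 m23 2 a) =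
      (-(a2 / a3) * p ^ 2 / q * ((p / q) ^ a)⁻¹ * (s (N + 1 - a) / s N)) • bv m13 m23 3 a := by
  by_cases h : lo 2 ≤ a ∧ a ≤ hi N 2
  · rw [redOp_bv_of_mem hN _ h]
    simp only [image, image32, bv, Matrix.cons_val]
    have hr : ratio p q (-1) = p / q := by
      simpa using ratio_intCast (p := p) (q := q) (-1)
    rw [show m13 - 1 - (m13 - a - 1) = a by ring,
      show m13 - a - 1 - (m23 - 2) = N + 1 - a by linear_combination hN,
      show 2 * ((m13 - m23) / 2) = (N : ℂ) by linear_combination hN, sub_eq_add_neg (a : ℂ) 1,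
      ratio_add hp hq, hr, ratio_intCast]
    congr 1
    rw [← inv_zpow, inv_div]; ring
  · rw [bv_eq_zero hN h, map_zero]
    by_cases h' : lo 3 ≤ a ∧ a ≤ hi N 3
    · have : a = N + 1 := by simp [lo, hi] at h h'; omega
      simp [this, s_zero hs]
    · simp [bv_eq_zero hN h']

lemma redOp_E32_three (hN : m13 - m23 = N) (a : ℤ) :
    redOp p q s a1 a2 a3 τ ε m13 m23 m33 .E32 (bv m13 m23 3 a) = 0 := by
  by_cases h : lo 3 ≤ a ∧ a ≤ hi N 3
  · rw [redOp_bv_of_mem hN _ h]; rfl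
  · simp [bv_eq_zero hN h]

end Operators

/-! ### The defining relations -/

section Relations

variable {p q : ℂ} {s : ℂ → ℂ} {a1 a2 a3 m13 m23 m33 : ℂ} {N : ℕ}

/-- The span of the reduced basis vectors of weight `w`. -/
def wtSpace (m13 m23 m33 : ℂ) (w : Fin 4 → ℂ) : Submodule ℂ (W m13 m23) :=
  Submodule.span ℂ {x | ∃ k a, wt m13 m23 m33 1 k a = w ∧ bv m13 m23 k a = x}

lemma bv_mem_wtSpace {w : Fin 4 → ℂ} {k : Fin 4} {a : ℤ} (h : wt m13 m23 m33 1 k a = w) :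
    bv m13 m23 k a ∈ wtSpace m13 m23 m33 w :=
  Submodule.subset_span ⟨k, a, h, rfl⟩

/-- The operators representing the generators. -/
abbrev repOp (p q : ℂ) (s : ℂ → ℂ) (a1 a2 a3 m13 m23 m33 : ℂ) (g : Gen) :
    W m13 m23 →ₗ[ℂ] W m13 m23 :=
  redOp p q s a1 a2 a3 (q / p) 1 m13 m23 m33 g

lemma repOp_H_of_mem (hN : m13 - m23 = N) (i : Fin 4) {w : Fin 4 → ℂ} {x : W m13 m23}
    (hx : x ∈ wtSpace m13 m23 m33 w) :
    repOp p q s a1 a2 a3 m13 m23 m33 (.H i) x = w i • x := by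
  induction hx using Submodule.span_induction with
  | mem x h => obtain ⟨k, a, rfl, rfl⟩ := h; exact redOp_H hN i k a
  | zero => simp
  | add x y _ _ hx hy => rw [map_add, hx, hy, smul_add]
  | smul c x _ hx => rw [map_smul, hx, smul_comm]

lemma repOp_expo_of_mem (hN : m13 - m23 = N) (c : Fin 4 → ℂ) {w : Fin 4 → ℂ} {x : W m13 m23}
    (hx : x ∈ wtSpace m13 m23 m33 w) :
    repOp p q s a1 a2 a3 m13 m23 m33 (.expo c) x = Complex.exp (∑ i, c i * w i) • x := by
  induction hx using Submodule.span_induction with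
  | mem x h => obtain ⟨k, a, rfl, rfl⟩ := h; exact redOp_expo hN c k a
  | zero => simp
  | add x y _ _ hx hy => rw [map_add, hx, hy, smul_add]
  | smul c x _ hx => rw [map_smul, hx, smul_comm]

/-- This single statement yields both Cartan-type relations, for E11, E22, E33, L and for the
exponentials. The shift of L by 1 on V_2 and V_3 is what gives E23 and E32 the L-weights -1/2 and
1/2. -/
lemma repOp_mem_wtSpace (hp : p ≠ 0) (hq : q ≠ 0) (hs : ∀ x, s x ^ 2 = br p q x)
    (hN : m13 - m23 = N) (g : Gen) (k : Fin 4) (a : ℤ) :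
    repOp p q s a1 a2 a3 m13 m23 m33 g (bv m13 m23 k a) ∈
      wtSpace m13 m23 m33 (wt m13 m23 m33 1 k a + root g) := by
  cases g with
  | H i =>
    rw [redOp_H hN]
    exact Submodule.smul_mem _ _ (bv_mem_wtSpace (by simp [root]))
  | expo c =>
    rw [redOp_expo hN]
    exact Submodule.smul_mem _ _ (bv_mem_wtSpace (by simp [root]))
  | E12 =>
    rw [redOp_E12 hs hN]
    refine Submodule.smul_mem _ _ (bv_mem_wtSpace ?_)
    funext i; fin_cases i <;> simp [root, wt] <;> ring
  | E21 =>
    rw [redOp_E21 hs hN]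
    refine Submodule.smul_mem _ _ (bv_mem_wtSpace ?_)
    funext i; fin_cases i <;> simp [root, wt] <;> ring
  | E23 =>
    have h : ∀ k' : Fin 4, wt m13 m23 m33 1 k' a = wt m13 m23 m33 1 k a + root .E23 → ∀ c : ℂ,
        c • bv m13 m23 k' a ∈ wtSpace m13 m23 m33 (wt m13 m23 m33 1 k a + root .E23) :=
      fun k' h c => Submodule.smul_mem _ _ (bv_mem_wtSpace h)
    fin_cases k <;> simp only [Fin.zero_eta, Fin.mk_one, Fin.reduceFinMk] at h ⊢
    · rw [redOp_E23_zero hN]; exact Submodule.zero_mem _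
    · rw [redOp_E23_one hN]
      refine h _ ?_ _
      funext i; fin_cases i <;> simp [root, wt]
    · rw [redOp_E23_two hp hq hs hN]
      refine h _ ?_ _
      funext i; fin_cases i <;> simp [root, wt]
      ring
    · rw [redOp_E23_three hp hq hs hN]
      refine Submodule.add_mem _ (h _ ?_ _) (h _ ?_ _)
      all_goals funext i; fin_cases i <;> simp [root, wt] <;> ring
  | E32 =>
    have h : ∀ k' : Fin 4, wt m13 m23 m33 1 k' a = wt m13 m23 m33 1 k a + root .E32 → ∀ c : ℂ,
        c • bv m13 m23 k' a ∈ wtSpace m13 m23 m33 (wt m13 m23 m33 1 k a + root .E32) :=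
      fun k' h c => Submodule.smul_mem _ _ (bv_mem_wtSpace h)
    fin_cases k <;> simp only [Fin.zero_eta, Fin.mk_one, Fin.reduceFinMk] at h ⊢
    · rw [redOp_E32_zero hp hq hs hN]
      refine Submodule.add_mem _ (h _ ?_ _) (h _ ?_ _)
      all_goals funext i; fin_cases i <;> simp [root, wt] <;> ring
    · rw [redOp_E32_one hN]
      refine h _ ?_ _
      funext i; fin_cases i <;> simp [root, wt] <;> ring
    · rw [redOp_E32_two hp hq hs hN]
      refine h _ ?_ _
      funext i; fin_cases i <;> simp [root, wt] <;> ring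
    · rw [redOp_E32_three hN]; exact Submodule.zero_mem _

/-- The action of the free algebra. -/
abbrev freeRep (p q : ℂ) (s : ℂ → ℂ) (a1 a2 a3 m13 m23 m33 : ℂ) :
    Free →ₐ[ℂ] Module.End ℂ (W m13 m23) :=
  FreeAlgebra.lift ℂ (repOp p q s a1 a2 a3 m13 m23 m33)

/-- The exponential of log r times a linear form acts on a weight vector by the principal power of
r, which links the operator brackets to `ratio` and `br`. -/
lemma freeRep_opPow {r : ℂ} (hr : r ≠ 0) (hN : m13 - m23 = N) (h : Fin 4 → ℂ) (k : Fin 4)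
    (a : ℤ) : freeRep p q s a1 a2 a3 m13 m23 m33 (opPow r h) (bv m13 m23 k a) =
      (r ^ (∑ i, h i * wt m13 m23 m33 1 k a i)) • bv m13 m23 k a := by
  rw [opPow, fg, FreeAlgebra.lift_ι_apply, redOp_expo hN, Complex.cpow_def_of_ne_zero hr,
    Finset.mul_sum]
  simp [mul_assoc]

lemma freeRep_opRatio_opBr (hp : p ≠ 0) (hq : q ≠ 0) (hN : m13 - m23 = N) (h h' : Fin 4 → ℂ)
    (k : Fin 4) (a : ℤ) :
    freeRep p q s a1 a2 a3 m13 m23 m33 (opRatio p q h * opBr p q h') (bv m13 m23 k a) =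
      (ratio p q (∑ i, h i * wt m13 m23 m33 1 k a i) *
        br p q (∑ i, h' i * wt m13 m23 m33 1 k a i)) • bv m13 m23 k a := by
  simp only [opRatio, opBr, map_mul, map_sub, map_smul, Module.End.mul_apply,
    LinearMap.sub_apply, LinearMap.smul_apply, freeRep_opPow hp hN, freeRep_opPow hq hN,
    ← sub_smul, smul_smul, Pi.neg_apply, neg_mul, Finset.sum_neg_distrib, ratio, br]
  congr 1; ring

lemma freeRep_cartan (hp : p ≠ 0) (hq : q ≠ 0) (hs : ∀ x, s x ^ 2 = br p q x)
    (hN : m13 - m23 = N) (i : Fin 4) (g : Gen) :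
    freeRep p q s a1 a2 a3 m13 m23 m33 (dcomm 1 (fg (.H i)) (fg g)) =
      freeRep p q s a1 a2 a3 m13 m23 m33 (root g i • fg g) := by
  refine hom_ext_bv hN fun k a => ?_
  simp only [dcomm, map_mul, map_sub, map_smul, Module.End.mul_apply,
    LinearMap.sub_apply, LinearMap.smul_apply, FreeAlgebra.lift_ι_apply, one_smul]
  rw [repOp_H_of_mem hN i (repOp_mem_wtSpace hp hq hs hN g k a), redOp_H hN, map_smul,
    ← sub_smul, Pi.add_apply, add_sub_cancel_left]

lemma freeRep_expo_comm (hp : p ≠ 0) (hq : q ≠ 0) (hs : ∀ x, s x ^ 2 = br p q x)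
    (hN : m13 - m23 = N) (c : Fin 4 → ℂ) (g : Gen) :
    freeRep p q s a1 a2 a3 m13 m23 m33 (fg (.expo c) * fg g) =
      freeRep p q s a1 a2 a3 m13 m23 m33
        (Complex.exp (∑ i, c i * root g i) • (fg g * fg (.expo c))) := by
  refine hom_ext_bv hN fun k a => ?_
  simp only [map_mul, map_smul, Module.End.mul_apply,
    LinearMap.smul_apply, FreeAlgebra.lift_ι_apply]
  rw [repOp_expo_of_mem hN c (repOp_mem_wtSpace hp hq hs hN g k a), redOp_expo hN, map_smul,
    smul_smul, ← Complex.exp_add, ← Finset.sum_add_distrib]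
  simp only [Pi.add_apply, mul_add, add_comm]

lemma freeRep_e12_e21 (hp : p ≠ 0) (hq : q ≠ 0) (hgen : ∀ n : ℕ, 0 < n → (p * q) ^ n ≠ 1)
    (hs : ∀ x, s x ^ 2 = br p q x) (hN : m13 - m23 = N) :
    freeRep p q s a1 a2 a3 m13 m23 m33 (dcomm 1 (fg .E12) (fg .E21)) =
      freeRep p q s a1 a2 a3 m13 m23 m33
        (opRatio p q (formL - (1 / 2 : ℂ) • h1) * opBr p q h1) := by
  refine hom_ext_bv hN fun k a => ?_
  rw [freeRep_opRatio_opBr hp hq hN]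
  -- The form L - h1/2 has eigenvalue a on every component. Its part `lo k` produces the factor q/p
  -- carried by E12 on V_2 and by E21 on V_3; the part `a - lo k` is the x of `br_commutator`.
  have e1 : ∑ i, (formL - (1 / 2 : ℂ) • h1) i * wt m13 m23 m33 1 k a i = lo k + (a - lo k) := by
    simp only [Fin.sum_univ_four]
    fin_cases k <;> simp [formL, h1, wt, lo] <;> ring
  have e2 : ∑ i, h1 i * wt m13 m23 m33 1 k a i = (hi N k - a) - (a - lo k) := by
    simp only [Fin.sum_univ_four]
    have : m13 = m23 + N := by linear_combination hN
    subst this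
    fin_cases k <;> simp [h1, wt, lo, hi] <;> ring
  have e3 : ratio p q (lo k) = ![1, 1, q / p, 1] k * ![1, 1, 1, q / p] k := by
    rw [ratio_intCast]
    fin_cases k <;> simp [lo]
  rw [e1, e2, ratio_add hp hq, e3, mul_assoc, ← br_commutator hp hq hgen]
  simp only [dcomm, map_mul, map_sub, map_smul, Module.End.mul_apply,
    LinearMap.sub_apply, FreeAlgebra.lift_ι_apply, one_smul, redOp_E12 hs hN,
    redOp_E21 hs hN, smul_smul, sub_add_cancel, add_sub_cancel_right, ← sub_smul,
    Int.cast_add, Int.cast_sub, Int.cast_one]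
  rw [show (hi N k : ℂ) + 1 - (a + 1) = hi N k - a by ring,
    show (a : ℂ) + 1 - lo k = a - lo k + 1 by ring,
    show (hi N k : ℂ) + 1 - a = hi N k - a + 1 by ring,
    show (hi N k : ℂ) - (a - 1) = hi N k - a + 1 by ring]
  simp only [← hs]
  congr 1; ring

lemma s_natCast_add_one_ne_zero (hp : p ≠ 0) (hgen : ∀ n : ℕ, 0 < n → (p * q) ^ n ≠ 1)
    (hs : ∀ x, s x ^ 2 = br p q x) (n : ℕ) : s (n + 1) ≠ 0 := by
  intro h
  have h1 := hs (n + 1)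
  rw [h] at h1
  refine br_intCast_ne_zero hp hgen (n := (n + 1 : ℤ)) (by omega) ?_
  push_cast
  rw [← h1]; simp

lemma s_intCast_ne_zero (hp : p ≠ 0) (hgen : ∀ n : ℕ, 0 < n → (p * q) ^ n ≠ 1)
    (hs : ∀ x, s x ^ 2 = br p q x) {n : ℤ} (hn : n ≠ 0) : s n ≠ 0 := by
  intro h
  have h1 := hs n
  rw [h] at h1
  refine br_intCast_ne_zero hp hgen hn ?_
  rw [← h1]; simp

lemma freeRep_e12_e32 (hp : p ≠ 0) (hq : q ≠ 0)
    (hs : ∀ x, s x ^ 2 = br p q x) (hN : m13 - m23 = N) :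
    freeRep p q s a1 a2 a3 m13 m23 m33 (dcomm 1 (fg .E12) (fg .E32)) =
      freeRep p q s a1 a2 a3 m13 m23 m33 0 := by
  have hpq : p / q ≠ 0 := div_ne_zero hp hq
  refine hom_ext_bv hN fun k a => ?_
  simp only [dcomm, map_mul, map_sub, map_zero, Module.End.mul_apply,
    LinearMap.sub_apply, FreeAlgebra.lift_ι_apply, one_smul, LinearMap.zero_apply]
  have hr : (p / q) ^ a ≠ 0 := zpow_ne_zero _ hpq
  fin_cases k <;> simp only [Fin.zero_eta, Fin.mk_one, Fin.reduceFinMk, redOp_E32_zero hp hq hs hN,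
    redOp_E32_one hN, redOp_E32_two hp hq hs hN, redOp_E32_three hN, redOp_E12 hs hN, map_add,
    map_smul, map_zero, smul_zero, sub_zero, smul_smul, lo, hi, Matrix.cons_val, Int.cast_add,
    Int.cast_sub, Int.cast_one, Int.cast_zero, Int.cast_natCast, zpow_sub_one₀ hpq]
  · rw [show (N : ℂ) + 1 - (a - 1) = N + 1 + 1 - a by ring]
    match_scalars
    · ring
    · field_simp
      ring
  · match_scalars
    ring
  · rw [show (N : ℂ) + 1 - (a - 1) = N + 1 + 1 - a by ring]
    match_scalars
    field_simp
    ring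

lemma freeRep_e21_e23 (hp : p ≠ 0) (hq : q ≠ 0)
    (hs : ∀ x, s x ^ 2 = br p q x) (hN : m13 - m23 = N) :
    freeRep p q s a1 a2 a3 m13 m23 m33 (dcomm 1 (fg .E21) (fg .E23)) =
      freeRep p q s a1 a2 a3 m13 m23 m33 0 := by
  have hpq : p / q ≠ 0 := div_ne_zero hp hq
  refine hom_ext_bv hN fun k a => ?_
  simp only [dcomm, map_mul, map_sub, map_zero, Module.End.mul_apply,
    LinearMap.sub_apply, FreeAlgebra.lift_ι_apply, one_smul, LinearMap.zero_apply]
  have hr : (p / q) ^ a ≠ 0 := zpow_ne_zero _ hpq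
  fin_cases k <;> simp only [Fin.zero_eta, Fin.mk_one, Fin.reduceFinMk, redOp_E23_zero hN,
    redOp_E23_one hN, redOp_E23_two hp hq hs hN, redOp_E23_three hp hq hs hN, redOp_E21 hs hN,
    map_add, map_smul, map_zero, smul_zero, sub_zero, smul_smul, lo, hi, Matrix.cons_val,
    Int.cast_add, Int.cast_one, Int.cast_zero, Int.cast_natCast,
    add_sub_cancel_right, add_sub_add_right_eq_sub, zpow_add_one₀ hpq]
  · match_scalars
    ring
  · match_scalars
    ring
  · match_scalars
    · field_simp
      ring
    · field_simp
      ring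

/-- Only V_3 can have a nonzero image, and there the routes to V_0 through V_1 and through V_2
contribute opposite scalars. -/
lemma freeRep_e23_sq (hp : p ≠ 0) (hq : q ≠ 0) (hgen : ∀ n : ℕ, 0 < n → (p * q) ^ n ≠ 1)
    (hs : ∀ x, s x ^ 2 = br p q x) (hN : m13 - m23 = N) (ha1 : a1 ≠ 0) (ha2 : a2 ≠ 0) :
    freeRep p q s a1 a2 a3 m13 m23 m33 (fg .E23 * fg .E23) =
      freeRep p q s a1 a2 a3 m13 m23 m33 0 := by
  refine hom_ext_bv hN fun k a => ?_
  simp only [map_mul, map_zero, Module.End.mul_apply, FreeAlgebra.lift_ι_apply,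
    LinearMap.zero_apply]
  fin_cases k <;> simp only [Fin.zero_eta, Fin.mk_one, Fin.reduceFinMk, redOp_E23_zero hN,
    redOp_E23_one hN, redOp_E23_two hp hq hs hN, redOp_E23_three hp hq hs hN,
    map_add, map_smul, map_zero, smul_zero, smul_smul]
  by_cases h : lo 3 ≤ a ∧ a ≤ hi N 3
  · have h1 := s_natCast_add_one_ne_zero hp hgen hs N
    -- For N = 0 the component V_2 is empty and the division by s N = 0 returns 0. The cancellation
    -- survives because a = 1 then makes the right-hand side s 0 = 0.
    have h2 : s (N + 1 - a) * s N / s N = s (N + 1 - a) := by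
      rcases eq_or_ne N 0 with rfl | h0
      · have : a = 1 := by simp [lo, hi] at h; omega
        simp [this, s_zero hs]
      · rw [mul_div_cancel_right₀]
        exact_mod_cast s_intCast_ne_zero hp hgen hs (n := N) (by exact_mod_cast h0)
    match_scalars
    rw [← hs (N + 1)]
    field_simp
    linear_combination (-a3 * ratio q p (m23 + m33) ^ 2 * (p / q) ^ a *
      s a * br p q (m23 + m33) * br p q (m23 + m33 + N + 1)) * h2
  · have h' : bv m13 m23 0 a = 0 ∨ s a = 0 := by
      by_cases h0 : lo 0 ≤ a ∧ a ≤ hi N 0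
      · right
        have : a = 0 := by simp [lo, hi] at h h0; omega
        simp [this, s_zero hs]
      · exact Or.inl (bv_eq_zero hN h0)
    rcases h' with h' | h' <;> simp [h']

lemma freeRep_e32_sq (hp : p ≠ 0) (hq : q ≠ 0) (hgen : ∀ n : ℕ, 0 < n → (p * q) ^ n ≠ 1)
    (hs : ∀ x, s x ^ 2 = br p q x) (hN : m13 - m23 = N) (ha1 : a1 ≠ 0) (ha2 : a2 ≠ 0) :
    freeRep p q s a1 a2 a3 m13 m23 m33 (fg .E32 * fg .E32) =
      freeRep p q s a1 a2 a3 m13 m23 m33 0 := by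
  have hpq : p / q ≠ 0 := div_ne_zero hp hq
  refine hom_ext_bv hN fun k a => ?_
  have hr : (p / q) ^ a ≠ 0 := zpow_ne_zero _ hpq
  simp only [map_mul, map_zero, Module.End.mul_apply, FreeAlgebra.lift_ι_apply,
    LinearMap.zero_apply]
  fin_cases k <;> simp only [Fin.zero_eta, Fin.mk_one, Fin.reduceFinMk, redOp_E32_zero hp hq hs hN,
    redOp_E32_one hN, redOp_E32_two hp hq hs hN, redOp_E32_three hN,
    map_add, map_smul, map_zero, smul_zero, smul_smul]
  by_cases h : lo 0 ≤ a ∧ a ≤ hi N 0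
  · have h1 := s_natCast_add_one_ne_zero hp hgen hs N
    -- When N = 0 the quotient by s N is 0 by convention, which agrees with s a because a = 0 is the
    -- only index left.
    have h2 : s a * s N / s N = s a := by
      rcases eq_or_ne N 0 with rfl | h0
      · have : a = 0 := by simp [lo, hi] at h; omega
        simp [this, s_zero hs]
      · rw [mul_div_cancel_right₀]
        exact_mod_cast s_intCast_ne_zero hp hgen hs (n := N) (by exact_mod_cast h0)
    match_scalars
    rw [← hs (N + 1)]
    generalize (p / q) ^ a = ρ at *
    field_simp
    linear_combination (-p / a3 * s (N + 1 - a)) * h2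
  · rcases eq_or_ne (a : ℂ) (N + 1) with h' | h'
    · simp [h', s_zero hs]
    · have h0 : ¬ (lo 3 ≤ a ∧ a ≤ hi N 3) := by
        have : a ≠ N + 1 := by exact_mod_cast h'
        simp [lo, hi] at h ⊢; omega
      simp [bv_eq_zero hN h0]

lemma freeRep_e23_e32 (hp : p ≠ 0) (hq : q ≠ 0) (hgen : ∀ n : ℕ, 0 < n → (p * q) ^ n ≠ 1)
    (hs : ∀ x, s x ^ 2 = br p q x) (hN : m13 - m23 = N)
    (ha1 : a1 ≠ 0) (ha2 : a2 ≠ 0) (ha3 : a3 ≠ 0) :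
    freeRep p q s a1 a2 a3 m13 m23 m33 (fg .E23 * fg .E32 + fg .E32 * fg .E23) =
      freeRep p q s a1 a2 a3 m13 m23 m33 (opRatio p q (-h2) * opBr p q h2) := by
  have hpq : p / q ≠ 0 := div_ne_zero hp hq
  refine hom_ext_bv hN fun k a => ?_
  by_cases h : lo k ≤ a ∧ a ≤ hi N k
  swap
  · simp [bv_eq_zero hN h]
  rw [freeRep_opRatio_opBr hp hq hN]
  have e1 : ∑ i, (-h2) i * wt m13 m23 m33 1 k a i = -(m23 + m33 + a) := by
    simp only [Fin.sum_univ_four]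
    fin_cases k <;> simp [h2, wt] <;> ring
  have e2 : ∑ i, h2 i * wt m13 m23 m33 1 k a i = m23 + m33 + a := by
    simp only [Fin.sum_univ_four]
    fin_cases k <;> simp [h2, wt] <;> ring
  have e3 : ratio p q (-(m23 + m33 + a)) = ratio q p (m23 + m33) * (p / q) ^ a := by
    rw [← ratio_intCast, ← ratio_add hq hp]
    simp [ratio, mul_comm]
  -- With this choice the identity reads [N+1-a] X + (p/q)^a [a] Y = [N+1] (p/q)^a [m23+m33+a]. Its
  -- right side is the eigenvalue required of the anticommutator up to the factors [N+1] and
  -- (p/q)^(m23+m33), and it settles the diagonal coefficient on all four components.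
  have key := br_anticommutator hp hq hgen (m23 + m33) (N + 1 - a) a
  rw [ratio_intCast, show (N : ℂ) + 1 - a + a = N + 1 by ring,
    show m23 + m33 + ((N : ℂ) + 1) = m23 + m33 + N + 1 by ring] at key
  have h1 := s_natCast_add_one_ne_zero hp hgen hs N
  rw [e1, e2, e3]
  simp only [map_add, map_mul, Module.End.mul_apply, LinearMap.add_apply,
    FreeAlgebra.lift_ι_apply]
  have hr : (p / q) ^ a ≠ 0 := zpow_ne_zero _ hpq
  generalize br p q (m23 + m33 + a) = Z at *
  rw [← hs (N + 1 - a), ← hs a, ← hs (N + 1)] at key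
  fin_cases k <;> simp only [Fin.zero_eta, Fin.mk_one, Fin.reduceFinMk, redOp_E32_zero hp hq hs hN,
    redOp_E32_one hN, redOp_E32_two hp hq hs hN, redOp_E32_three hN, redOp_E23_zero hN,
    redOp_E23_one hN, redOp_E23_two hp hq hs hN, redOp_E23_three hp hq hs hN,
    map_add, map_smul, map_zero, add_zero, zero_add, smul_smul, ← hs (N + 1)] at h ⊢
  all_goals generalize (p / q) ^ a = ρ at *
  all_goals generalize ratio q p (m23 + m33) = ξ at *
  all_goals generalize br p q (m23 + m33) = X at *
  all_goals generalize br p q (m23 + m33 + N + 1) = Y at *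
  · have h2 : s a * s N / s N = s a := by
      rcases eq_or_ne N 0 with rfl | h0
      · have : a = 0 := by simp [lo, hi] at h; omega
        simp [this, s_zero hs]
      · rw [mul_div_cancel_right₀]
        exact_mod_cast s_intCast_ne_zero hp hgen hs (n := N) (by exact_mod_cast h0)
    match_scalars
    field_simp
    linear_combination ξ * key + ξ * ρ * Y * s a * h2
  · match_scalars
    · field_simp
      linear_combination ξ * key
    · field_simp
      ring
  -- A vector in V_2 has 1 ≤ a ≤ N, so N is positive and s N can be cancelled.
  · have h2 : s N ≠ 0 := by
      refine s_intCast_ne_zero hp hgen hs (n := N) ?_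
      simp [lo, hi] at h; omega
    match_scalars
    · field_simp
      ring
    · field_simp
      linear_combination ξ * key
  · have h2 : s (N + 1 - a) * s N / s N = s (N + 1 - a) := by
      rcases eq_or_ne N 0 with rfl | h0
      · have : a = 1 := by simp [lo, hi] at h; omega
        simp [this, s_zero hs]
      · rw [mul_div_cancel_right₀]
        exact_mod_cast s_intCast_ne_zero hp hgen hs (n := N) (by exact_mod_cast h0)
    match_scalars
    field_simp
    linear_combination ξ * key + ξ * X * s (N + 1 - a) * h2

lemma sq_recurrence (hp : p ≠ 0) (hq : q ≠ 0) (hs : ∀ x, s x ^ 2 = br p q x) (y : ℂ) :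
    s (y + 1 + 1) ^ 2 - (q + p⁻¹) * s (y + 1) ^ 2 + q / p * s y ^ 2 = 0 := by
  have := br_recurrence hp hq (y + 1)
  rw [add_sub_cancel_right] at this
  rw [hs, hs, hs, this]

/-- The relation expands to E12² E23 - (p + 1/q) E12 E23 E12 + (p/q) E23 E12². In each transition
all s-factors but one square are common, and that square runs over three consecutive brackets. The
factors q/p of E12 on V_2 and the power (p/q)^a in E23 adjust the coefficients so that
`sq_recurrence` applies, in a or in N + 1 - a. -/
lemma freeRep_serre_plus (hp : p ≠ 0) (hq : q ≠ 0)
    (hs : ∀ x, s x ^ 2 = br p q x) (hN : m13 - m23 = N) :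
    freeRep p q s a1 a2 a3 m13 m23 m33 (dcomm p (fg .E12) (E13 q)) =
      freeRep p q s a1 a2 a3 m13 m23 m33 0 := by
  have hpq : p / q ≠ 0 := div_ne_zero hp hq
  refine hom_ext_bv hN fun k a => ?_
  simp only [E13, dcomm, map_mul, map_sub, map_smul, map_zero, Module.End.mul_apply,
    LinearMap.sub_apply, FreeAlgebra.lift_ι_apply, LinearMap.zero_apply, LinearMap.smul_apply]
  have hr : (p / q) ^ a ≠ 0 := zpow_ne_zero _ hpq
  have hy := sq_recurrence hp hq hs (N + 1 - a)
  have ha := sq_recurrence hp hq hs (a - 1 - 1)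
  simp only [sub_add_cancel] at ha
  -- As s is an arbitrary function, equal arguments must be brought to the same form before its
  -- values can be treated as unknowns.
  have f1 : (N : ℂ) + 1 - (a - 1) = N + 1 - a + 1 := by ring
  have f2 : (N : ℂ) + 1 - (a - 1 - 1) = N + 1 - a + 1 + 1 := by ring
  have f3 : (N : ℂ) + 1 + 1 - a = N + 1 - a + 1 := by ring
  have f4 : (N : ℂ) + 1 + 1 - (a - 1) = N + 1 - a + 1 + 1 := by ring
  fin_cases k <;> simp only [Fin.zero_eta, Fin.mk_one, Fin.reduceFinMk, redOp_E23_zero hN,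
    redOp_E23_one hN, redOp_E23_two hp hq hs hN, redOp_E23_three hp hq hs hN, redOp_E12 hs hN,
    map_add, map_smul, map_zero, smul_zero, sub_zero, smul_smul, lo, hi, Matrix.cons_val,
    Int.cast_add, Int.cast_sub, Int.cast_one, Int.cast_zero, Int.cast_natCast,
    zpow_sub_one₀ hpq, f1, f2, f3, f4]
  all_goals generalize (p / q) ^ a = ρ at *
  all_goals generalize ratio q p (m23 + m33) = ξ at *
  all_goals generalize s (N + 1 - a) = y0 at *
  all_goals generalize s (N + 1 - a + 1) = y1 at *
  all_goals generalize s (N + 1 - a + 1 + 1) = y2 at *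
  all_goals generalize s (a - 1 - 1) = b2 at *
  all_goals generalize s (a - 1) = b1 at *
  all_goals generalize s a = b0 at *
  all_goals match_scalars
  all_goals field_simp at hy ha ⊢
  -- The four identities belong to the transitions V_1 → V_0, V_2 → V_0, V_3 → V_1 and V_3 → V_2.
  · linear_combination (y1 * b0 * b1 * a1 * ξ * br p q (m23 + m33) / s (N + 1)) * hy
  · linear_combination (y1 * y0 * b1 * a2 * ξ * br p q (m23 + m33 + N + 1) / s N) * ha
  · linear_combination
      (y2 * y1 * b1 * a3 * ξ * ρ * br p q (m23 + m33 + N + 1) / a1 / s (N + 1)) * ha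
  · linear_combination
      (-q ^ 2 * y1 * b1 * b2 * a3 * ξ * ρ * br p q (m23 + m33) * s N / a2 / br p q (N + 1)) * hy

/-- The mechanism is that of the raising case, now with E21² E32 - (q + 1/p) E21 E32 E21 + (q/p) E32
E21² and the transitions V_0 → V_1, V_0 → V_2, V_1 → V_3, V_2 → V_3. -/
lemma freeRep_serre_minus (hp : p ≠ 0) (hq : q ≠ 0)
    (hs : ∀ x, s x ^ 2 = br p q x) (hN : m13 - m23 = N) :
    freeRep p q s a1 a2 a3 m13 m23 m33 (dcomm q (fg .E21) (E31 p)) =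
      freeRep p q s a1 a2 a3 m13 m23 m33 0 := by
  have hpq : p / q ≠ 0 := div_ne_zero hp hq
  refine hom_ext_bv hN fun k a => ?_
  simp only [E31, dcomm, map_mul, map_sub, map_neg, map_smul, map_zero, Module.End.mul_apply,
    LinearMap.sub_apply, LinearMap.neg_apply, FreeAlgebra.lift_ι_apply, LinearMap.zero_apply,
    LinearMap.smul_apply]
  have hr : (p / q) ^ a ≠ 0 := zpow_ne_zero _ hpq
  have hy := sq_recurrence hp hq hs (N + 1 - a - 1 - 1)
  have ha := sq_recurrence hp hq hs a
  simp only [sub_add_cancel] at hy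
  have f0 : (N : ℂ) - a = N + 1 - a - 1 := by ring
  have f1 : (N : ℂ) + 1 - (a + 1) = N + 1 - a - 1 := by ring
  have f2 : (N : ℂ) + 1 - (a + 1 + 1) = N + 1 - a - 1 - 1 := by ring
  have f3 : (N : ℂ) - (a + 1) = N + 1 - a - 1 - 1 := by ring
  fin_cases k <;> simp only [Fin.zero_eta, Fin.mk_one, Fin.reduceFinMk, redOp_E32_zero hp hq hs hN,
    redOp_E32_one hN, redOp_E32_two hp hq hs hN, redOp_E32_three hN, redOp_E21 hs hN,
    map_add, map_smul, map_zero, smul_zero, sub_zero, neg_zero, smul_smul, lo, hi, Matrix.cons_val,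
    Int.cast_add, Int.cast_one, Int.cast_zero, Int.cast_natCast,
    add_sub_cancel_right, zpow_add_one₀ hpq, f0, f1, f2, f3]
  all_goals generalize (p / q) ^ a = ρ at *
  all_goals generalize s (N + 1 - a - 1 - 1) = y2 at *
  all_goals generalize s (N + 1 - a - 1) = y1 at *
  all_goals generalize s (N + 1 - a) = y0 at *
  all_goals generalize s (a + 1 + 1) = b2 at *
  all_goals generalize s (a + 1) = b1 at *
  all_goals generalize s a = b0 at *
  all_goals match_scalars
  all_goals field_simp at hy ha ⊢
  · linear_combination (-(y1 * b2 * b1) / a1 / s (N + 1)) * hy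
  · linear_combination (-(y1 * y2 * b1) * ρ * s N / a2 / br p q (N + 1)) * ha
  · linear_combination (-(y0 * q * y1 * b1 * a1) / a3 / s (N + 1)) * ha
  · linear_combination (q * y1 * b1 * b0 * a2 / a3 / s N) * hy

/-- The operators of the reduced basis respect the defining relations. -/
lemma freeRep_rel (hp : p ≠ 0) (hq : q ≠ 0) (hgen : ∀ n : ℕ, 0 < n → (p * q) ^ n ≠ 1)
    (hs : ∀ x, s x ^ 2 = br p q x) (hN : m13 - m23 = N)
    (ha1 : a1 ≠ 0) (ha2 : a2 ≠ 0) (ha3 : a3 ≠ 0) ⦃x y : Free⦄ (h : Rel p q x y) :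
    freeRep p q s a1 a2 a3 m13 m23 m33 x = freeRep p q s a1 a2 a3 m13 m23 m33 y := by
  cases h with
  | cartan i g => exact freeRep_cartan hp hq hs hN i g
  | expo_zero =>
    refine hom_ext_bv hN fun k a => ?_
    simp [redOp_expo hN]
  | expo_add c d =>
    refine hom_ext_bv hN fun k a => ?_
    simp [redOp_expo hN, smul_smul, ← Complex.exp_add, add_mul, Finset.sum_add_distrib, add_comm]
  | expo_comm c g => exact freeRep_expo_comm hp hq hs hN c g
  | e12_e21 => exact freeRep_e12_e21 hp hq hgen hs hN
  | e23_e32 => exact freeRep_e23_e32 hp hq hgen hs hN ha1 ha2 ha3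
  | e12_e32 => exact freeRep_e12_e32 hp hq hs hN
  | e21_e23 => exact freeRep_e21_e23 hp hq hs hN
  | e23_sq => exact freeRep_e23_sq hp hq hgen hs hN ha1 ha2
  | e32_sq => exact freeRep_e32_sq hp hq hgen hs hN ha1 ha2
  | serre_plus => exact freeRep_serre_plus hp hq hs hN
  | serre_minus => exact freeRep_serre_minus hp hq hs hN

lemma exists_rep (hp : p ≠ 0) (hq : q ≠ 0) (hgen : ∀ n : ℕ, 0 < n → (p * q) ^ n ≠ 1)
    (hs : ∀ x, s x ^ 2 = br p q x) (hN : m13 - m23 = N)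
    (ha1 : a1 ≠ 0) (ha2 : a2 ≠ 0) (ha3 : a3 ≠ 0) :
    ∃ ρ : U p q →ₐ[ℂ] Module.End ℂ (W m13 m23),
      ∀ g, ρ (gen p q g) = redOp p q s a1 a2 a3 (q / p) 1 m13 m23 m33 g := by
  refine ⟨RingQuot.liftAlgHom ℂ ⟨freeRep p q s a1 a2 a3 m13 m23 m33,
    freeRep_rel hp hq hgen hs hN ha1 ha2 ha3⟩, fun g => ?_⟩
  refine (RingQuot.liftAlgHom_mkAlgHom_apply ..).trans ?_
  simp

end Relations

/-! ### Invariant subspaces -/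

section Irreducibility

variable {p q : ℂ} {s : ℂ → ℂ} {a1 a2 a3 τ ε m13 m23 m33 : ℂ} {N : ℕ}

lemma bv_ne_zero (hN : m13 - m23 = N) {k : Fin 4} {a : ℤ} (h : lo k ≤ a ∧ a ≤ hi N k) :
    bv m13 m23 k a ≠ 0 := by
  rw [bv_eq_single hN h]; simp

lemma mem_range_of_bv_ne_zero (hN : m13 - m23 = N) {k : Fin 4} {a : ℤ}
    (h : bv m13 m23 k a ≠ 0) : lo k ≤ a ∧ a ≤ hi N k :=
  not_not.1 fun h' => h (bv_eq_zero hN h')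

lemma bv_add_one_mem (hp : p ≠ 0) (hgen : ∀ n : ℕ, 0 < n → (p * q) ^ n ≠ 1)
    (hs : ∀ x, s x ^ 2 = br p q x) (hN : m13 - m23 = N) (hτ : τ ≠ 0)
    {S : Submodule ℂ (W m13 m23)}
    (hS : ∀ g, ∀ x ∈ S, redOp p q s a1 a2 a3 τ ε m13 m23 m33 g x ∈ S)
    {k : Fin 4} {a : ℤ} (h1 : lo k ≤ a) (h2 : a < hi N k) (h : bv m13 m23 k a ∈ S) :
    bv m13 m23 k (a + 1) ∈ S := by
  have := hS .E21 _ h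
  rw [redOp_E21 hs hN] at this
  refine (S.smul_mem_iff (mul_ne_zero ?_ (mul_ne_zero ?_ ?_))).1 this
  · fin_cases k <;> simp [hτ]
  · exact_mod_cast s_intCast_ne_zero hp hgen hs (n := a + 1 - lo k) (by omega)
  · exact_mod_cast s_intCast_ne_zero hp hgen hs (n := hi N k - a) (by omega)

lemma bv_sub_one_mem (hp : p ≠ 0) (hgen : ∀ n : ℕ, 0 < n → (p * q) ^ n ≠ 1)
    (hs : ∀ x, s x ^ 2 = br p q x) (hN : m13 - m23 = N) (hτ : τ ≠ 0)
    {S : Submodule ℂ (W m13 m23)}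
    (hS : ∀ g, ∀ x ∈ S, redOp p q s a1 a2 a3 τ ε m13 m23 m33 g x ∈ S)
    {k : Fin 4} {a : ℤ} (h1 : lo k < a) (h2 : a ≤ hi N k) (h : bv m13 m23 k a ∈ S) :
    bv m13 m23 k (a - 1) ∈ S := by
  have := hS .E12 _ h
  rw [redOp_E12 hs hN] at this
  refine (S.smul_mem_iff (mul_ne_zero ?_ (mul_ne_zero ?_ ?_))).1 this
  · fin_cases k <;> simp [hτ]
  · exact_mod_cast s_intCast_ne_zero hp hgen hs (n := a - lo k) (by omega)
  · exact_mod_cast s_intCast_ne_zero hp hgen hs (n := hi N k + 1 - a) (by omega)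

/-- The components are irreducible under the even generators. -/
lemma bv_mem_of_bv_mem (hp : p ≠ 0) (hgen : ∀ n : ℕ, 0 < n → (p * q) ^ n ≠ 1)
    (hs : ∀ x, s x ^ 2 = br p q x) (hN : m13 - m23 = N) (hτ : τ ≠ 0)
    {S : Submodule ℂ (W m13 m23)}
    (hS : ∀ g, ∀ x ∈ S, redOp p q s a1 a2 a3 τ ε m13 m23 m33 g x ∈ S)
    {k : Fin 4} {a b : ℤ} (ha : lo k ≤ a ∧ a ≤ hi N k) (hb : lo k ≤ b ∧ b ≤ hi N k)
    (h : bv m13 m23 k a ∈ S) : bv m13 m23 k b ∈ S := by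
  rcases le_total a b with hab | hab
  · induction b, hab using Int.leInduction with
    | base => exact h
    | succ n hn ih =>
      exact bv_add_one_mem hp hgen hs hN hτ hS (by omega) (by omega) (ih (by omega))
  · induction b, hab using Int.leInductionDown with
    | base => exact h
    | pred n hn ih =>
      exact bv_sub_one_mem hp hgen hs hN hτ hS (by omega) (by omega) (ih (by omega))

/-- The component `V_0` generates the whole space. -/
lemma eq_top_of_bv_zero_mem (hp : p ≠ 0) (hq : q ≠ 0)
    (hgen : ∀ n : ℕ, 0 < n → (p * q) ^ n ≠ 1)
    (hs : ∀ x, s x ^ 2 = br p q x) (hN : m13 - m23 = N) (hτ : τ ≠ 0)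
    (ha1 : a1 ≠ 0) (ha2 : a2 ≠ 0) (ha3 : a3 ≠ 0)
    {S : Submodule ℂ (W m13 m23)}
    (hS : ∀ g, ∀ x ∈ S, redOp p q s a1 a2 a3 τ ε m13 m23 m33 g x ∈ S)
    {a : ℤ} (ha : lo 0 ≤ a ∧ a ≤ hi N 0) (h : bv m13 m23 0 a ∈ S) : S = ⊤ := by
  have hsN := s_natCast_add_one_ne_zero hp hgen hs N
  have hr : ∀ b : ℤ, (p / q) ^ b ≠ 0 := fun b => zpow_ne_zero _ (div_ne_zero hp hq)
  have v0 : ∀ b, lo 0 ≤ b ∧ b ≤ hi N 0 → bv m13 m23 0 b ∈ S := fun b hb =>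
    bv_mem_of_bv_mem hp hgen hs hN hτ hS ha hb h
  -- At a = 0 the V_2 part of the image of E32 carries s 0 = 0, so a pure V_1 vector appears. With
  -- V_1 available, the V_2 part of other images can be isolated by subtraction.
  have v10 : bv m13 m23 1 0 ∈ S := by
    have := hS .E32 _ (v0 0 (by simp [lo, hi]))
    rw [redOp_E32_zero hp hq hs hN] at this
    simp only [Int.cast_zero, sub_zero, s_zero hs, zero_mul, zero_div, mul_zero, zero_smul,
      add_zero, div_self hsN, mul_one] at this
    exact (S.smul_mem_iff (one_div_ne_zero ha1)).1 this
  have v1 : ∀ b, lo 1 ≤ b ∧ b ≤ hi N 1 → bv m13 m23 1 b ∈ S := fun b hb =>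
    bv_mem_of_bv_mem hp hgen hs hN hτ hS (by simp [lo, hi]; omega) hb v10
  refine span_bv hN S fun k b hb1 hb2 => ?_
  fin_cases k <;> simp only [Fin.zero_eta, Fin.mk_one, Fin.reduceFinMk] at hb1 hb2 ⊢
  · exact v0 b ⟨hb1, hb2⟩
  · exact v1 b ⟨hb1, hb2⟩
  · simp only [lo, hi, Matrix.cons_val] at hb1 hb2
    have h1 := hS .E32 _ (v0 b (by simp [lo, hi]; omega))
    rw [redOp_E32_zero hp hq hs hN, S.add_mem_iff_right
      (S.smul_mem _ (v1 b (by simp [lo, hi]; omega)))] at h1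
    refine (S.smul_mem_iff ?_).1 h1
    have e1 := s_intCast_ne_zero hp hgen hs (n := b) (by omega)
    have e2 : s N ≠ 0 := s_intCast_ne_zero hp hgen hs (n := N) (by omega)
    have e3 : br p q (N + 1) ≠ 0 := by rw [← hs]; exact pow_ne_zero 2 hsN
    exact mul_ne_zero (mul_ne_zero (mul_ne_zero (one_div_ne_zero ha2) (div_ne_zero hq hp)) (hr b))
      (div_ne_zero (mul_ne_zero e1 e2) e3)
  · simp only [lo, hi, Matrix.cons_val] at hb1 hb2
    have h1 := hS .E32 _ (v1 b (by simp [lo, hi]; omega))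
    rw [redOp_E32_one hN] at h1
    refine (S.smul_mem_iff ?_).1 h1
    have e1 := s_intCast_ne_zero hp hgen hs (n := b) (by omega)
    positivity

/-- The eigenvalues of the Cartan generators on a pattern. -/
def patternWeight (m33 ε : ℂ) (m : Pattern m13 m23) : Fin 4 → ℂ :=
  gzWeight (row12 m13 m.1) (row22 m23 m.1) (row31 m33 m.1) (![0, 0, ε, ε] m.1) m.2.1

lemma redOp_H_apply (hN : m13 - m23 = N) (i : Fin 4) (x : W m13 m23) (m : Pattern m13 m23) :
    redOp p q s a1 a2 a3 τ ε m13 m23 m33 (.H i) x m = patternWeight m33 ε m i * x m := by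
  induction x using Finsupp.induction_linear with
  | zero => simp
  | add f g hf hg => simp only [map_add, Finsupp.add_apply, hf, hg, mul_add]
  | single m' c =>
    obtain ⟨a, ha, hm, he⟩ := exists_eq_bv hN m'
    have hw : patternWeight m33 ε m' = wt m13 m23 m33 ε m'.1 a := by
      rw [patternWeight, hm, gzWeight_eq]
    have : Finsupp.single m' c = c • bv m13 m23 m'.1 a := by rw [← he]; simp
    rw [this, map_smul, redOp_H hN, ← hw, ← he]
    rcases eq_or_ne m' m with rfl | hne
    · simp [mul_comm]
    · simp [Finsupp.single_eq_of_ne' hne]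

/-- A nonzero invariant subspace contains a nonzero weight vector. -/
lemma exists_weight_vector (hN : m13 - m23 = N) {S : Submodule ℂ (W m13 m23)}
    (hS : ∀ g, ∀ x ∈ S, redOp p q s a1 a2 a3 τ ε m13 m23 m33 g x ∈ S) (n : ℕ) :
    ∀ x ∈ S, x ≠ 0 → x.support.card = n → ∃ y ∈ S, y ≠ 0 ∧ ∀ m ∈ y.support, ∀ m' ∈ y.support,
      patternWeight m33 ε m = patternWeight m33 ε m' := by
  induction n using Nat.strong_induction_on with
  | _ n ih =>
    intro x hx hx0 hn
    by_contra! hcon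
    obtain ⟨m, hm, m', hm', hne⟩ := hcon x hx hx0
    obtain ⟨i, hi⟩ := Function.ne_iff.1 hne
    -- Subtracting the eigenvalue of m kills the coefficient at m and keeps the one at m', so the
    -- support shrinks without becoming empty.
    set y := redOp p q s a1 a2 a3 τ ε m13 m23 m33 (.H i) x - patternWeight m33 ε m i • x
    have hy : ∀ r, y r = (patternWeight m33 ε r i - patternWeight m33 ε m i) * x r := fun r => by
      simp only [y, Finsupp.sub_apply, Finsupp.smul_apply, redOp_H_apply hN, smul_eq_mul, sub_mul]
    have hyS : y ∈ S := S.sub_mem (hS _ _ hx) (S.smul_mem _ hx)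
    have hy0 : y ≠ 0 := by
      intro h0
      have := hy m'
      rw [h0, Finsupp.zero_apply, eq_comm, mul_eq_zero, sub_eq_zero] at this
      rcases this with h | h
      · exact hi h.symm
      · exact Finsupp.mem_support_iff.1 hm' h
    have hcard : y.support.card < n := by
      rw [← hn]
      refine Finset.card_lt_card ⟨fun r hr => ?_, fun hsub => ?_⟩
      · rw [Finsupp.mem_support_iff, hy] at hr
        exact Finsupp.mem_support_iff.2 (right_ne_zero_of_mul hr)
      · have := Finsupp.mem_support_iff.1 (hsub hm)
        rw [hy, sub_self, zero_mul] at this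
        exact this rfl
    obtain ⟨z, hz, hz0, hw⟩ := ih _ hcard y hyS hy0 rfl
    obtain ⟨r, hr, r', hr', hne'⟩ := hcon z hz hz0
    exact hne' (hw r hr r' hr')

/-- The number of odd lowering operators leading from `V_0` to `V_k`. -/
def level : Fin 4 → ℕ := ![0, 1, 1, 2]

lemma patternWeight_two (m : Pattern m13 m23) :
    patternWeight m33 ε m 2 = m33 + level m.1 := by
  obtain ⟨k, m11⟩ := m
  fin_cases k <;> simp [patternWeight, gzWeight, row31, level]

/-- The eigenvalue of E11 fixes a and that of E33 fixes the level. The eigenvalue of L is not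
consulted, which makes the argument independent of ε; vectors of V_1 and V_2 with equal a may remain
mixed. -/
lemma exists_mem_span_level (hN : m13 - m23 = N) {S : Submodule ℂ (W m13 m23)}
    (hS : ∀ g, ∀ x ∈ S, redOp p q s a1 a2 a3 τ ε m13 m23 m33 g x ∈ S) (hS0 : S ≠ ⊥) :
    ∃ x ∈ S, x ≠ 0 ∧ ∃ (a : ℤ) (k₀ : Fin 4),
      x ∈ Submodule.span ℂ {y | ∃ k, level k = level k₀ ∧ bv m13 m23 k a = y} := by
  obtain ⟨x₀, hx₀, hne₀⟩ := S.exists_mem_ne_zero_of_ne_bot hS0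
  obtain ⟨x, hx, hne, hw⟩ := exists_weight_vector (m33 := m33) (ε := ε) hN hS _ x₀ hx₀ hne₀ rfl
  obtain ⟨m, hm⟩ := Finsupp.support_nonempty_iff.2 hne
  obtain ⟨a, -, hma, -⟩ := exists_eq_bv hN m
  refine ⟨x, hx, hne, a, m.1, ?_⟩
  rw [← Finsupp.sum_single x, Finsupp.sum]
  refine Submodule.sum_mem _ fun m' hm' => ?_
  obtain ⟨a', -, hma', he⟩ := exists_eq_bv hN m'
  have h := hw m' hm' m hm
  have h0 : m'.2.1 = m.2.1 := by
    have := congrFun h 0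
    simpa [patternWeight, gzWeight] using this
  have h2 : level m'.1 = level m.1 := by
    have := congrFun h 2
    rw [patternWeight_two, patternWeight_two] at this
    exact_mod_cast add_left_cancel this
  have haa : a' = a := by
    rw [hma, hma'] at h0
    exact_mod_cast sub_right_injective h0
  subst haa
  have : Finsupp.single m' (x m') = x m' • bv m13 m23 m'.1 a' := by rw [← he]; simp
  rw [this]
  exact Submodule.smul_mem _ _ (Submodule.subset_span ⟨m'.1, h2, rfl⟩)

/-- Raising a combination of vectors of `V_1` and `V_2` of the same weight leads to the highest
weight vector of `V_1`. -/
lemma bv_one_zero_mem (hp : p ≠ 0) (hgen : ∀ n : ℕ, 0 < n → (p * q) ^ n ≠ 1)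
    (hs : ∀ x, s x ^ 2 = br p q x) (hN : m13 - m23 = N)
    {S : Submodule ℂ (W m13 m23)}
    (hS : ∀ g, ∀ x ∈ S, redOp p q s a1 a2 a3 τ ε m13 m23 m33 g x ∈ S) (n : ℕ) (hn : n ≤ N + 1) :
    ∀ α β : ℂ, α ≠ 0 → α • bv m13 m23 1 n + β • bv m13 m23 2 n ∈ S → bv m13 m23 1 0 ∈ S := by
  induction n with
  | zero =>
    intro α β hα h
    -- V_2 starts at a = 1 while V_1 starts at a = 0, so the top step of raising eliminates the V_2
    -- part.
    rw [bv_eq_zero hN (k := 2) (by simp [lo]), smul_zero, add_zero] at h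
    exact (S.smul_mem_iff hα).1 h
  | succ n ih =>
    intro α β hα h
    have h1 := hS .E12 _ h
    rw [map_add, map_smul, map_smul, redOp_E12 hs hN, redOp_E12 hs hN, smul_smul, smul_smul,
      show ((n + 1 : ℕ) : ℤ) - 1 = n by push_cast; ring] at h1
    refine ih (by omega) _ _ (mul_ne_zero hα (mul_ne_zero ?_ (mul_ne_zero ?_ ?_))) h1
    · simp
    · exact_mod_cast s_intCast_ne_zero hp hgen hs (n := ((n + 1 : ℕ) : ℤ) - lo 1)
        (by simp [lo]; omega)
    · exact_mod_cast s_intCast_ne_zero hp hgen hs (n := hi N 1 + 1 - ((n + 1 : ℕ) : ℤ))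
        (by simp [hi]; omega)

lemma eq_top_of_ne_bot (hp : p ≠ 0) (hq : q ≠ 0)
    (hgen : ∀ n : ℕ, 0 < n → (p * q) ^ n ≠ 1)
    (hs : ∀ x, s x ^ 2 = br p q x) (hN : m13 - m23 = N) (hτ : τ ≠ 0)
    (ha1 : a1 ≠ 0) (ha2 : a2 ≠ 0) (ha3 : a3 ≠ 0)
    (hX : br p q (m23 + m33) ≠ 0) (hY : br p q (m23 + m33 + N + 1) ≠ 0)
    {S : Submodule ℂ (W m13 m23)}
    (hS : ∀ g, ∀ x ∈ S, redOp p q s a1 a2 a3 τ ε m13 m23 m33 g x ∈ S) (hS0 : S ≠ ⊥) :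
    S = ⊤ := by
  have hsN := s_natCast_add_one_ne_zero hp hgen hs N
  have hr : ∀ b : ℤ, (p / q) ^ b ≠ 0 := fun b => zpow_ne_zero _ (div_ne_zero hp hq)
  have hξ := ratio_ne_zero hq hp (m23 + m33)
  have of_zero : ∀ a, lo 0 ≤ a ∧ a ≤ hi N 0 → bv m13 m23 0 a ∈ S → S = ⊤ := fun a ha h =>
    eq_top_of_bv_zero_mem hp hq hgen hs hN hτ ha1 ha2 ha3 hS ha h
  have of_one : bv m13 m23 1 0 ∈ S → S = ⊤ := fun h => by
    have h1 := hS .E23 _ h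
    rw [redOp_E23_one hN] at h1
    refine of_zero 0 (by simp [lo, hi]) ((S.smul_mem_iff ?_).1 h1)
    simp only [Int.cast_zero, sub_zero]
    positivity
  obtain ⟨x, hx, hx0, a, k₀, hspan⟩ := exists_mem_span_level hN hS hS0
  have hk : level k₀ = 0 ∨ level k₀ = 1 ∨ level k₀ = 2 := by
    fin_cases k₀ <;> simp [level]
  rcases hk with hk | hk | hk
  · have hset : {y | ∃ k, level k = level k₀ ∧ bv m13 m23 k a = y} = {bv m13 m23 0 a} := by
      rw [hk]; ext y; simp [Fin.exists_fin_succ, level, eq_comm]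
    rw [hset, Submodule.mem_span_singleton] at hspan
    obtain ⟨c, rfl⟩ := hspan
    exact of_zero a (mem_range_of_bv_ne_zero hN (smul_ne_zero_iff.1 hx0).2)
      ((S.smul_mem_iff (smul_ne_zero_iff.1 hx0).1).1 hx)
  · have hset : {y | ∃ k, level k = level k₀ ∧ bv m13 m23 k a = y} =
        {bv m13 m23 1 a, bv m13 m23 2 a} := by
      rw [hk]; ext y; simp [Fin.exists_fin_succ, level, eq_comm]
    rw [hset, Submodule.mem_span_pair] at hspan
    obtain ⟨α, β, rfl⟩ := hspan
    -- Without a V_1 part the vector lies in V_2 and E23 takes it to V_0 with factor Y; V_2 being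
    -- nonempty makes s N nonzero. With a V_1 part, raising leads to the highest vector of V_1,
    -- which E23 takes to V_0 with factor X.
    rcases eq_or_ne α 0 with rfl | hα
    · rw [zero_smul, zero_add] at hx hx0
      have ha := mem_range_of_bv_ne_zero hN (smul_ne_zero_iff.1 hx0).2
      simp only [lo, hi, Matrix.cons_val] at ha
      have h1 := hS .E23 _ ((S.smul_mem_iff (smul_ne_zero_iff.1 hx0).1).1 hx)
      rw [redOp_E23_two hp hq hs hN] at h1
      refine of_zero a (by simp [lo, hi]; omega) ((S.smul_mem_iff ?_).1 h1)
      have e1 := s_intCast_ne_zero hp hgen hs (n := a) (by omega)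
      have e2 : s N ≠ 0 := s_intCast_ne_zero hp hgen hs (n := N) (by omega)
      positivity
    · have ha : lo 1 ≤ a ∧ a ≤ hi N 1 := by
        by_contra h
        have h' : ¬ (lo 2 ≤ a ∧ a ≤ hi N 2) := by
          simp [lo, hi] at h ⊢; omega
        exact hx0 (by simp [bv_eq_zero hN h, bv_eq_zero hN h'])
      simp only [lo, hi, Matrix.cons_val] at ha
      obtain ⟨n, rfl⟩ := Int.eq_ofNat_of_zero_le ha.1
      exact of_one (bv_one_zero_mem hp hgen hs hN hS n (by omega) α β hα hx)
  · have hset : {y | ∃ k, level k = level k₀ ∧ bv m13 m23 k a = y} = {bv m13 m23 3 a} := by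
      rw [hk]; ext y; simp [Fin.exists_fin_succ, level, eq_comm]
    rw [hset, Submodule.mem_span_singleton] at hspan
    obtain ⟨c, rfl⟩ := hspan
    have ha := mem_range_of_bv_ne_zero hN (smul_ne_zero_iff.1 hx0).2
    -- The last index a = N + 1 occurs in V_1 and V_3 but not in V_2, so E23 sends this vector into
    -- V_1 alone, with factor Y.
    have h3 : bv m13 m23 3 (N + 1) ∈ S :=
      bv_mem_of_bv_mem hp hgen hs hN hτ hS ha (by simp [lo, hi])
        ((S.smul_mem_iff (smul_ne_zero_iff.1 hx0).1).1 hx)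
    have h1 := hS .E23 _ h3
    rw [redOp_E23_three hp hq hs hN, bv_eq_zero hN (k := 2) (by simp [lo, hi]), smul_zero,
      add_zero] at h1
    have h1' : bv m13 m23 1 (N + 1) ∈ S := by
      refine (S.smul_mem_iff ?_).1 h1
      have := hr (N + 1)
      push_cast
      positivity
    exact of_one (bv_mem_of_bv_mem hp hgen hs hN hτ hS (by simp [lo, hi]; omega)
      (by simp [lo, hi]; omega) h1')

/-- The span of the components with index in `K`. -/
def compSpan (m13 m23 : ℂ) (K : Set (Fin 4)) : Submodule ℂ (W m13 m23) :=
  Finsupp.supported ℂ ℂ {m | m.1 ∈ K}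

lemma bv_mem_compSpan (hN : m13 - m23 = N) {K : Set (Fin 4)} {k : Fin 4} (hk : k ∈ K) (a : ℤ) :
    bv m13 m23 k a ∈ compSpan m13 m23 K := by
  by_cases h : lo k ≤ a ∧ a ≤ hi N k
  · rw [bv_eq_single hN h]
    exact Finsupp.single_mem_supported ℂ _ hk
  · rw [bv_eq_zero hN h]; exact Submodule.zero_mem _

lemma map_mem_compSpan (hN : m13 - m23 = N) {K : Set (Fin 4)} {f : W m13 m23 →ₗ[ℂ] W m13 m23}
    (h : ∀ k ∈ K, ∀ a, f (bv m13 m23 k a) ∈ compSpan m13 m23 K) {x : W m13 m23}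
    (hx : x ∈ compSpan m13 m23 K) : f x ∈ compSpan m13 m23 K := by
  have : compSpan m13 m23 K ≤ (compSpan m13 m23 K).comap f := by
    conv_lhs => rw [compSpan, Finsupp.supported_eq_span_single]
    rw [Submodule.span_le]
    rintro _ ⟨m, hm, rfl⟩
    obtain ⟨a, -, -, he⟩ := exists_eq_bv hN m
    simp only [he]
    exact h _ hm a
  exact this hx

lemma not_irreducible_of_compSpan (hN : m13 - m23 = N) {op : Gen → W m13 m23 →ₗ[ℂ] W m13 m23}
    {K : Set (Fin 4)} (h0 : 0 ∉ K) (h3 : 3 ∈ K)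
    (h : ∀ g, ∀ k ∈ K, ∀ a, op g (bv m13 m23 k a) ∈ compSpan m13 m23 K) :
    ¬ IrreducibleFamily op := by
  rintro ⟨-, hirr⟩
  rcases hirr (compSpan m13 m23 K) (fun g x hx => map_mem_compSpan hN (h g) hx) with hb | ht
  · have := bv_mem_compSpan hN h3 1
    rw [hb, Submodule.mem_bot] at this
    exact bv_ne_zero hN (by simp [lo, hi]) this
  · have h00 : lo 0 ≤ 0 ∧ 0 ≤ hi N 0 := by simp [lo, hi]
    have : bv m13 m23 0 0 ∈ compSpan m13 m23 K := by rw [ht]; exact Submodule.mem_top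
    rw [bv_eq_single hN h00, compSpan, Finsupp.mem_supported,
      Finsupp.support_single _ one_ne_zero] at this
    exact h0 (this (Finset.mem_coe.2 (Finset.mem_singleton_self _)))

lemma even_mem_compSpan (hs : ∀ x, s x ^ 2 = br p q x) (hN : m13 - m23 = N) {K : Set (Fin 4)}
    {k : Fin 4} (hk : k ∈ K) (a : ℤ) {g : Gen} (h23 : g ≠ .E23) (h32 : g ≠ .E32) :
    redOp p q s a1 a2 a3 τ ε m13 m23 m33 g (bv m13 m23 k a) ∈ compSpan m13 m23 K := by
  cases g with
  | H i => rw [redOp_H hN]; exact Submodule.smul_mem _ _ (bv_mem_compSpan hN hk _)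
  | expo c => rw [redOp_expo hN]; exact Submodule.smul_mem _ _ (bv_mem_compSpan hN hk _)
  | E12 => rw [redOp_E12 hs hN]; exact Submodule.smul_mem _ _ (bv_mem_compSpan hN hk _)
  | E21 => rw [redOp_E21 hs hN]; exact Submodule.smul_mem _ _ (bv_mem_compSpan hN hk _)
  | E23 => exact absurd rfl h23
  | E32 => exact absurd rfl h32

/-- No defining relation enters, only matrix elements, so any nonzero τ and any ε are allowed; both
irreducibility criteria of the theorem are instances. -/
lemma irreducibleFamily_iff (hp : p ≠ 0) (hq : q ≠ 0)
    (hgen : ∀ n : ℕ, 0 < n → (p * q) ^ n ≠ 1)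
    (hs : ∀ x, s x ^ 2 = br p q x) (hN : m13 - m23 = N) (hτ : τ ≠ 0)
    (ha1 : a1 ≠ 0) (ha2 : a2 ≠ 0) (ha3 : a3 ≠ 0) :
    IrreducibleFamily (redOp p q s a1 a2 a3 τ ε m13 m23 m33) ↔
      br p q (m23 + m33 + N + 1) * br p q (m23 + m33) ≠ 0 := by
  constructor
  · intro hirr h
    rcases mul_eq_zero.1 h with hY | hX
    · refine not_irreducible_of_compSpan hN (K := {2, 3}) (by simp) (by simp) ?_ hirr
      intro g k hk a
      by_cases h23 : g = .E23
      · subst h23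
        rcases hk with rfl | rfl
        · simp [redOp_E23_two hp hq hs hN, hY]
        · simpa [redOp_E23_three hp hq hs hN, hY] using
            Submodule.smul_mem _ _ (bv_mem_compSpan hN (by simp) a)
      by_cases h32 : g = .E32
      · subst h32
        rcases hk with rfl | rfl
        · rw [redOp_E32_two hp hq hs hN]
          exact Submodule.smul_mem _ _ (bv_mem_compSpan hN (by simp) a)
        · simp [redOp_E32_three hN]
      exact even_mem_compSpan hs hN hk a h23 h32
    · refine not_irreducible_of_compSpan hN (K := {1, 3}) (by simp) (by simp) ?_ hirr
      intro g k hk a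
      by_cases h23 : g = .E23
      · subst h23
        rcases hk with rfl | rfl
        · simp [redOp_E23_one hN, hX]
        · simpa [redOp_E23_three hp hq hs hN, hX] using
            Submodule.smul_mem _ _ (bv_mem_compSpan hN (by simp) a)
      by_cases h32 : g = .E32
      · subst h32
        rcases hk with rfl | rfl
        · rw [redOp_E32_one hN]
          exact Submodule.smul_mem _ _ (bv_mem_compSpan hN (by simp) a)
        · simp [redOp_E32_three hN]
      exact even_mem_compSpan hs hN hk a h23 h32
  · intro h
    refine ⟨⟨bv m13 m23 0 0, 0, bv_ne_zero hN (by simp [lo, hi])⟩, fun S hS => ?_⟩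
    rw [or_iff_not_imp_left]
    exact eq_top_of_ne_bot hp hq hgen hs hN hτ ha1 ha2 ha3 (right_ne_zero_of_mul h)
      (left_ne_zero_of_mul h) hS

end Irreducibility

/-! ### Dimensions -/

section Dimension

variable {m13 m23 : ℂ} {N : ℕ}

/-- Patterns of the `k`-th component, parametrized by integers. -/
def gzEquiv (hN : m13 - m23 = N) (k : Fin 4) :
    Finset.Icc (lo k) (hi N k) ≃ GZ (row12 m13 k) (row22 m23 k) :=
  Equiv.ofBijective
    (fun a => ⟨m13 - (a.1 : ℂ), (isPattern_iff hN k a.1).2 (Finset.mem_Icc.1 a.2)⟩) <| by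
    constructor
    · intro a b h
      have := congrArg Subtype.val h
      exact Subtype.ext (by exact_mod_cast sub_right_injective this)
    · intro x
      obtain ⟨a, ha, hx, -⟩ := exists_eq_bv hN (⟨k, x⟩ : Pattern m13 m23)
      exact ⟨⟨a, Finset.mem_Icc.2 ha⟩, Subtype.ext hx.symm⟩

lemma finite_gz (hN : m13 - m23 = N) (k : Fin 4) : Finite (GZ (row12 m13 k) (row22 m23 k)) :=
  Finite.of_equiv _ (gzEquiv hN k)

lemma card_gz (hN : m13 - m23 = N) (k : Fin 4) :
    Nat.card (GZ (row12 m13 k) (row22 m23 k)) = (hi N k + 1 - lo k).toNat := by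
  rw [← Nat.card_congr (gzEquiv hN k), Nat.card_eq_fintype_card, Fintype.card_coe,
    Int.card_Icc]

lemma finite_pattern (hN : m13 - m23 = N) : Finite (Pattern m13 m23) := by
  have := finite_gz hN
  infer_instance

lemma finiteDimensional_W (hN : m13 - m23 = N) : FiniteDimensional ℂ (W m13 m23) := by
  have := finite_pattern hN
  infer_instance

/-- The components have N+1, N+2, N and N+1 patterns. -/
lemma finrank_W (hN : m13 - m23 = N) : Module.finrank ℂ (W m13 m23) = 4 * (N + 1) := by
  have := finite_gz hN
  have := finite_pattern hN
  have := Fintype.ofFinite (Pattern m13 m23)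
  rw [Module.finrank_finsupp_self, ← Nat.card_eq_fintype_card, Nat.card_sigma]
  simp only [card_gz hN, Fin.sum_univ_four, lo, hi, Matrix.cons_val]
  omega

lemma finite_gz_zero (hN : m13 - m23 = N) : Finite (GZ m13 m23) := finite_gz hN 0

lemma finrank_V0 (hN : m13 - m23 = N) : Module.finrank ℂ (V0 m13 m23) = N + 1 := by
  have := finite_gz_zero hN
  have := Fintype.ofFinite (GZ m13 m23)
  rw [Module.finrank_finsupp_self, ← Nat.card_eq_fintype_card]
  refine (card_gz hN 0).trans ?_
  simp [lo, hi]

end Dimension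

/-! ### Relations in the quantum superalgebra -/

section Algebra

variable {p q : ℂ}

lemma proj_rel {x y : Free} (h : Rel p q x y) : proj p q x = proj p q y :=
  RingQuot.mkAlgHom_rel ℂ h

lemma proj_surjective : Function.Surjective (proj p q) :=
  RingQuot.mkAlgHom_surjective ℂ (Rel p q)

/-- The lowering operator `E31` in the quotient. -/
def gen31 (p q : ℂ) : U p q :=
  -(gen p q .E21 * gen p q .E32 - p⁻¹ • (gen p q .E32 * gen p q .E21))

lemma proj_E31 : proj p q (E31 p) = gen31 p q := by
  simp [E31, dcomm, gen31, gen]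

lemma e21_mul_e32 : gen p q .E21 * gen p q .E32 =
    p⁻¹ • (gen p q .E32 * gen p q .E21) - gen31 p q := by
  rw [gen31]; abel

lemma e32_mul_e32 : gen p q .E32 * gen p q .E32 = 0 := by
  simpa [gen] using proj_rel (Rel.e32_sq (p := p) (q := q))

lemma e12_mul_e32 : gen p q .E12 * gen p q .E32 = gen p q .E32 * gen p q .E12 := by
  have := proj_rel (Rel.e12_e32 (p := p) (q := q))
  simpa [gen, dcomm, sub_eq_zero] using this

lemma e23_mul_e21 : gen p q .E23 * gen p q .E21 = gen p q .E21 * gen p q .E23 := by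
  have := proj_rel (Rel.e21_e23 (p := p) (q := q))
  rw [dcomm, map_sub, one_smul, map_mul, map_mul, map_zero, sub_eq_zero] at this
  exact this.symm

lemma e21_mul_e31 : gen p q .E21 * gen31 p q = q • (gen31 p q * gen p q .E21) := by
  have := proj_rel (Rel.serre_minus (p := p) (q := q))
  rw [dcomm, map_sub, map_smul, map_mul, map_mul, proj_E31, map_zero, sub_eq_zero] at this
  exact this

/-- Put F = E32, E = E21, c = 1/p + q. Multiplying the Serre relation by F on the left and on the
right expresses c FEFE and c EFEF as multiples of FEEF. In c E31² the coefficients of FEEF then add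
up to q/p - c/p + 1/p² = 0, and c ≠ 0 since (pq)² ≠ 1. -/
lemma e31_mul_e31 (hp : p ≠ 0) (hgen : ∀ n : ℕ, 0 < n → (p * q) ^ n ≠ 1) :
    gen31 p q * gen31 p q = 0 := by
  have hc := inv_add_ne_zero hp hgen
  have hF : gen p q .E32 * gen p q .E32 = 0 := e32_mul_e32
  have hS := e21_mul_e31 (p := p) (q := q)
  rw [gen31] at hS ⊢
  generalize gen p q .E32 = F at *
  generalize gen p q .E21 = E at *
  have hF' : ∀ x, F * (F * x) = 0 := fun x => by rw [← mul_assoc, hF, zero_mul]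
  have h1 := congrArg (F * ·) hS
  have h2 := congrArg (· * F) hS
  simp only [mul_sub, sub_mul, smul_mul_assoc, mul_smul_comm, mul_assoc, hF, hF',
    mul_zero, smul_zero, sub_zero, zero_sub, smul_sub, neg_sub, smul_smul] at h1 h2 ⊢
  have h1' : (p⁻¹ + q) • (F * (E * (F * E))) = F * (E * (E * F)) := by
    linear_combination (norm := module) h1
  have h2' : (p⁻¹ + q) • (E * (F * (E * F))) = (q * p⁻¹) • (F * (E * (E * F))) := by
    linear_combination (norm := module) h2
  have h3 : (p⁻¹ + q) • (E * (F * (E * F)) - p⁻¹ • (F * (E * (E * F))) +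
      (p⁻¹ * p⁻¹) • (F * (E * (F * E)))) = 0 := by
    rw [smul_add, smul_sub, h2', smul_comm _ (p⁻¹ * p⁻¹), h1']
    module
  have h4 := (smul_eq_zero.1 h3).resolve_left hc
  rw [← h4]
  module

lemma H_mul (i : Fin 4) (g : Gen) : gen p q (.H i) * gen p q g =
    gen p q g * (gen p q (.H i) + algebraMap ℂ _ (root g i)) := by
  have := proj_rel (Rel.cartan (p := p) (q := q) i g)
  rw [dcomm, map_sub, map_smul, map_smul, map_mul, map_mul, one_smul, sub_eq_iff_eq_add] at this
  rw [mul_add, ← Algebra.commutes, ← Algebra.smul_def, add_comm]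
  exact this

lemma expo_mul (c : Fin 4 → ℂ) (g : Gen) : gen p q (.expo c) * gen p q g =
    gen p q g * (Complex.exp (∑ i, c i * root g i) • gen p q (.expo c)) := by
  have := proj_rel (Rel.expo_comm (p := p) (q := q) c g)
  rw [map_smul, map_mul, map_mul] at this
  rw [mul_smul_comm]
  exact this

/-- The Cartan subalgebra. -/
def cartan (p q : ℂ) : Subalgebra ℂ (U p q) :=
  Algebra.adjoin ℂ (Set.range (fun i => gen p q (.H i)) ∪ Set.range fun c => gen p q (.expo c))

lemma H_mem_cartan (i : Fin 4) : gen p q (.H i) ∈ cartan p q :=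
  Algebra.subset_adjoin (Or.inl ⟨i, rfl⟩)

lemma expo_mem_cartan (c : Fin 4 → ℂ) : gen p q (.expo c) ∈ cartan p q :=
  Algebra.subset_adjoin (Or.inr ⟨c, rfl⟩)

/-- The elements that the Cartan subalgebra can be moved past. -/
def IsWeight (z : U p q) : Prop := ∀ x ∈ cartan p q, ∃ y ∈ cartan p q, x * z = z * y

lemma isWeight_of_generators {z : U p q} {w : Fin 4 → ℂ} {χ : (Fin 4 → ℂ) → ℂ}
    (hH : ∀ i, gen p q (.H i) * z = z * (gen p q (.H i) + algebraMap ℂ _ (w i)))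
    (hexpo : ∀ c, gen p q (.expo c) * z = z * (χ c • gen p q (.expo c))) : IsWeight z := by
  intro x hx
  induction hx using Algebra.adjoin_induction with
  | mem x hx =>
    rcases hx with ⟨i, rfl⟩ | ⟨c, rfl⟩
    · exact ⟨_, add_mem (H_mem_cartan i) (Subalgebra.algebraMap_mem _ _), hH i⟩
    · exact ⟨_, Subalgebra.smul_mem _ (expo_mem_cartan c) _, hexpo c⟩
  | algebraMap r => exact ⟨_, Subalgebra.algebraMap_mem _ r, Algebra.commutes r z⟩
  | add x x' _ _ hx hx' =>
    obtain ⟨y, hy, h⟩ := hx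
    obtain ⟨y', hy', h'⟩ := hx'
    exact ⟨_, add_mem hy hy', by rw [add_mul, mul_add, h, h']⟩
  | mul x x' _ _ hx hx' =>
    obtain ⟨y, hy, h⟩ := hx
    obtain ⟨y', hy', h'⟩ := hx'
    exact ⟨_, mul_mem hy hy', by rw [mul_assoc, h', ← mul_assoc, h, mul_assoc]⟩

lemma isWeight_gen (g : Gen) : IsWeight (gen p q g) :=
  isWeight_of_generators (fun i => H_mul i g) (fun c => expo_mul c g)

/-- Both monomials E21 E32 and E32 E21 have the same weight, the sum of the two roots. -/
lemma isWeight_gen31 : IsWeight (gen31 p q) := by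
  refine isWeight_of_generators (w := fun i => root .E21 i + root .E32 i)
    (χ := fun c => Complex.exp (∑ i, c i * root .E21 i) * Complex.exp (∑ i, c i * root .E32 i))
    (fun i => ?_) (fun c => ?_)
  · have h1 := H_mul (p := p) (q := q) i .E21
    have h2 := H_mul (p := p) (q := q) i .E32
    rw [gen31]
    generalize gen p q .E32 = F at *
    generalize gen p q .E21 = E at *
    generalize gen p q (.H i) = D at *
    simp only [Algebra.algebraMap_eq_smul_one, mul_add, mul_smul_comm, mul_one] at *
    have h3 : D * (E * F) = E * (F * D) + (root .E21 i + root .E32 i) • (E * F) := by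
      rw [← mul_assoc, h1, add_mul, mul_assoc, h2, mul_add, smul_mul_assoc, mul_smul_comm]
      module
    have h4 : D * (F * E) = F * (E * D) + (root .E21 i + root .E32 i) • (F * E) := by
      rw [← mul_assoc, h2, add_mul, mul_assoc, h1, mul_add, smul_mul_assoc, mul_smul_comm]
      module
    simp only [mul_neg, neg_mul, mul_sub, sub_mul, mul_smul_comm, smul_mul_assoc, h3, h4,
      mul_assoc]
    module
  · have h1 := expo_mul (p := p) (q := q) c .E21
    have h2 := expo_mul (p := p) (q := q) c .E32
    rw [gen31]
    generalize gen p q .E32 = F at *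
    generalize gen p q .E21 = E at *
    generalize gen p q (.expo c) = D at *
    generalize Complex.exp (∑ i, c i * root .E21 i) = x at *
    generalize Complex.exp (∑ i, c i * root .E32 i) = y at *
    simp only [mul_smul_comm] at *
    have h3 : D * (E * F) = (x * y) • (E * (F * D)) := by
      rw [← mul_assoc, h1, smul_mul_assoc, mul_assoc, h2, mul_smul_comm]
      module
    have h4 : D * (F * E) = (x * y) • (F * (E * D)) := by
      rw [← mul_assoc, h2, smul_mul_assoc, mul_assoc, h1, mul_smul_comm]
      module
    simp only [mul_neg, neg_mul, mul_sub, sub_mul, mul_smul_comm, smul_mul_assoc, h3, h4,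
      mul_assoc]
    module

lemma proj_opRatio_opBr_mem_cartan (h h' : Fin 4 → ℂ) :
    proj p q (opRatio p q h * opBr p q h') ∈ cartan p q := by
  simp only [opRatio, opBr, opPow, map_mul, map_smul, map_sub]
  exact mul_mem (mul_mem (expo_mem_cartan _) (expo_mem_cartan _))
    (Subalgebra.smul_mem _ (sub_mem (expo_mem_cartan _) (expo_mem_cartan _)) _)

/-- Since E12 commutes with E32 and its commutator with E21 is in the Cartan part, commuting E12
past E31 leaves E32 times a Cartan element. -/
lemma exists_e12_mul_e31 : ∃ b ∈ cartan p q,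
    gen p q .E12 * gen31 p q = gen31 p q * gen p q .E12 + gen p q .E32 * b := by
  have h := proj_rel (Rel.e12_e21 (p := p) (q := q))
  have hK := proj_opRatio_opBr_mem_cartan (p := p) (q := q) (formL - (1 / 2 : ℂ) • h1) h1
  rw [← h] at hK
  set K := proj p q (dcomm 1 (fg .E12) (fg .E21)) with hKdef
  have hA : gen p q .E12 * gen p q .E21 = gen p q .E21 * gen p q .E12 + K := by
    simp [hKdef, dcomm, gen]
  obtain ⟨K', hK', hKF⟩ := isWeight_gen .E32 K hK
  refine ⟨p⁻¹ • K - K', sub_mem (Subalgebra.smul_mem _ hK _) hK', ?_⟩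
  have hAF := e12_mul_e32 (p := p) (q := q)
  rw [gen31]
  generalize gen p q .E32 = F at *
  generalize gen p q .E21 = E at *
  generalize gen p q .E12 = A at *
  have e1 : A * (E * F) = E * (F * A) + F * K' := by
    rw [← mul_assoc, hA, add_mul, mul_assoc, hAF, hKF]
  have e2 : A * (F * E) = F * (E * A) + F * K := by
    rw [← mul_assoc, hAF, mul_assoc, hA, mul_add]
  simp only [mul_neg, neg_mul, mul_sub, sub_mul, mul_smul_comm, smul_mul_assoc, e1, e2, mul_assoc]
  module

lemma exists_e23_mul_e32 : ∃ b ∈ cartan p q,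
    gen p q .E23 * gen p q .E32 = b - gen p q .E32 * gen p q .E23 := by
  have h := proj_rel (Rel.e23_e32 (p := p) (q := q))
  refine ⟨_, proj_opRatio_opBr_mem_cartan (-h2) h2, ?_⟩
  rw [← h, map_add, map_mul, map_mul]
  exact (add_sub_cancel_right _ _).symm

lemma e23_mul_e31 {b : U p q} (h : gen p q .E23 * gen p q .E32 = b - gen p q .E32 * gen p q .E23) :
    gen p q .E23 * gen31 p q =
      p⁻¹ • (b * gen p q .E21) - gen p q .E21 * b - gen31 p q * gen p q .E23 := by
  have hC := e23_mul_e21 (p := p) (q := q)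
  rw [gen31]
  generalize gen p q .E32 = F at *
  generalize gen p q .E21 = E at *
  generalize gen p q .E23 = C at *
  have e1 : C * (E * F) = E * b - E * (F * C) := by
    rw [← mul_assoc, hC, mul_assoc, h, mul_sub]
  have e2 : C * (F * E) = b * E - F * (E * C) := by
    rw [← mul_assoc, h, sub_mul, mul_assoc, hC]
  simp only [mul_neg, neg_mul, mul_sub, sub_mul, mul_smul_comm, smul_mul_assoc, e1, e2, mul_assoc]
  module

end Algebra

/-! ### The induced module -/

section Induced

variable {p q : ℂ} {s : ℂ → ℂ} {m13 m23 m33 : ℂ} {N : ℕ}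

/-- The subspaces stable under the generators are stable under the whole algebra. -/
lemma smul_mem_of_gen {X : Type*} [AddCommGroup X] [Module ℂ X] [Module (U p q) X]
    [IsScalarTower ℂ (U p q) X] {S : Submodule ℂ X}
    (hS : ∀ g, ∀ x ∈ S, gen p q g • x ∈ S) (u : U p q) : ∀ x ∈ S, u • x ∈ S := by
  obtain ⟨f, rfl⟩ := proj_surjective u
  induction f using FreeAlgebra.induction with
  | grade0 r =>
    intro x hx
    rw [AlgHom.commutes, algebraMap_smul]
    exact S.smul_mem r hx
  | grade1 g => exact hS g
  | mul a b ha hb =>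
    intro x hx
    rw [map_mul, mul_smul]
    exact ha _ (hb _ hx)
  | add a b ha hb =>
    intro x hx
    rw [map_add, add_smul]
    exact S.add_mem (ha _ hx) (hb _ hx)

/-- The class of `u ⊗ v`, as a bilinear map. -/
def mkBilin (p q : ℂ) (s : ℂ → ℂ) (m13 m23 m33 : ℂ) :
    U p q →ₗ[ℂ] V0 m13 m23 →ₗ[ℂ] Induced p q s m13 m23 m33 :=
  (TensorProduct.mk ℂ (U p q) (V0 m13 m23)).compr₂
    ((inducedRel p q s m13 m23 m33).mkQ.restrictScalars ℂ)

lemma mkBilin_apply (u : U p q) (v : V0 m13 m23) :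
    mkBilin p q s m13 m23 m33 u v = Induced.mk p q s m13 m23 m33 u v := rfl

lemma smul_mkBilin (u w : U p q) (v : V0 m13 m23) :
    u • mkBilin p q s m13 m23 m33 w v = mkBilin p q s m13 m23 m33 (u * w) v := by
  rw [mkBilin_apply, mkBilin_apply, Induced.mk, Induced.mk, ← map_smul,
    TensorProduct.smul_tmul', smul_eq_mul]

lemma mkBilin_mul_gen (u : U p q) {b : Gen} (hb : b ≠ .E32) (v : V0 m13 m23) :
    mkBilin p q s m13 m23 m33 (u * gen p q b) v =
      mkBilin p q s m13 m23 m33 u (V0op s m13 m23 m33 b v) := by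
  rw [mkBilin_apply, mkBilin_apply, Induced.mk, Induced.mk, ← sub_eq_zero, ← map_sub,
    Submodule.mkQ_apply, Submodule.Quotient.mk_eq_zero]
  exact Submodule.subset_span ⟨u, b, v, hb, rfl⟩

/-- The elements of the algebra that preserve `u ⊗ V_0` when acting from the right on `u`. -/
def rightStable (p q : ℂ) (s : ℂ → ℂ) (m13 m23 m33 : ℂ) : Subalgebra ℂ (U p q) where
  carrier := {b | ∀ (u : U p q) (v : V0 m13 m23), ∃ v',
    mkBilin p q s m13 m23 m33 (u * b) v = mkBilin p q s m13 m23 m33 u v'}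
  mul_mem' {b b'} hb hb' u v := by
    obtain ⟨v', h'⟩ := hb' (u * b) v
    obtain ⟨v'', h''⟩ := hb u v'
    exact ⟨v'', by rw [← mul_assoc, h', h'']⟩
  add_mem' {b b'} hb hb' u v := by
    obtain ⟨v', h'⟩ := hb u v
    obtain ⟨v'', h''⟩ := hb' u v
    exact ⟨v' + v'', by rw [mul_add, map_add, LinearMap.add_apply, h', h'', map_add]⟩
  algebraMap_mem' r u v :=
    ⟨r • v, by rw [← Algebra.commutes, ← Algebra.smul_def, map_smul, LinearMap.smul_apply,
      map_smul]⟩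

lemma gen_mem_rightStable {b : Gen} (hb : b ≠ .E32) :
    gen p q b ∈ rightStable p q s m13 m23 m33 :=
  fun u v => ⟨_, mkBilin_mul_gen u hb v⟩

lemma cartan_le_rightStable : cartan p q ≤ rightStable p q s m13 m23 m33 := by
  refine Algebra.adjoin_le ?_
  rintro _ (⟨i, rfl⟩ | ⟨c, rfl⟩)
  · exact gen_mem_rightStable (by simp)
  · exact gen_mem_rightStable (by simp)

/-- The products of odd lowering operators. -/
def frame (p q : ℂ) : Fin 4 → U p q :=
  ![1, gen p q .E32, gen31 p q, gen p q .E32 * gen31 p q]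

/-- The map from four copies of `V_0` to the induced module, given by the products of odd lowering
operators. -/
def frameMap (p q : ℂ) (s : ℂ → ℂ) (m13 m23 m33 : ℂ) :
    (Fin 4 → V0 m13 m23) →ₗ[ℂ] Induced p q s m13 m23 m33 :=
  ∑ i, (mkBilin p q s m13 m23 m33 (frame p q i)).comp (LinearMap.proj i)

/-- The elements `u` such that `u ⊗ V_0` is in the range of `frameMap`. -/
def frameSpan (p q : ℂ) (s : ℂ → ℂ) (m13 m23 m33 : ℂ) : Submodule ℂ (U p q) where
  carrier := {u | ∀ v, mkBilin p q s m13 m23 m33 u v ∈ LinearMap.range (frameMap p q s m13 m23 m33)}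
  add_mem' {u u'} hu hu' v := by
    rw [map_add, LinearMap.add_apply]
    exact Submodule.add_mem _ (hu v) (hu' v)
  zero_mem' v := by
    rw [map_zero, LinearMap.zero_apply]
    exact Submodule.zero_mem _
  smul_mem' c u hu v := by
    rw [map_smul, LinearMap.smul_apply]
    exact Submodule.smul_mem _ _ (hu v)

lemma frame_mem_frameSpan (i : Fin 4) : frame p q i ∈ frameSpan p q s m13 m23 m33 := by
  intro v
  refine ⟨Pi.single i v, ?_⟩
  rw [frameMap, LinearMap.sum_apply, Finset.sum_eq_single i]
  · simp
  · intro k _ hk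
    simp [Pi.single_eq_of_ne hk]
  · simp

lemma mul_mem_frameSpan {u b : U p q} (hu : u ∈ frameSpan p q s m13 m23 m33)
    (hb : b ∈ rightStable p q s m13 m23 m33) : u * b ∈ frameSpan p q s m13 m23 m33 := by
  intro v
  obtain ⟨v', h⟩ := hb u v
  rw [h]
  exact hu v'

/-- This is the straightening step: a generator times a product of odd lowering operators is
rewritten with those products on the left and, on the right, factors which V_0 absorbs. -/
lemma gen_mul_frame_mem (hp : p ≠ 0) (hgen : ∀ n : ℕ, 0 < n → (p * q) ^ n ≠ 1) (g : Gen)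
    (i : Fin 4) : gen p q g * frame p q i ∈ frameSpan p q s m13 m23 m33 := by
  have hJ : (1 : U p q) ∈ frameSpan p q s m13 m23 m33 := frame_mem_frameSpan 0
  have hF : gen p q .E32 ∈ frameSpan p q s m13 m23 m33 := frame_mem_frameSpan 1
  have hY : gen31 p q ∈ frameSpan p q s m13 m23 m33 := frame_mem_frameSpan 2
  have hFY : gen p q .E32 * gen31 p q ∈ frameSpan p q s m13 m23 m33 := frame_mem_frameSpan 3
  have hone : ∀ b ∈ rightStable p q s m13 m23 m33, b ∈ frameSpan p q s m13 m23 m33 :=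
    fun b hb => by simpa using mul_mem_frameSpan hJ hb
  have hcartan : ∀ x ∈ cartan p q, ∀ i, x * frame p q i ∈ frameSpan p q s m13 m23 m33 := by
    intro x hx i
    obtain ⟨y, hy, hxF⟩ := isWeight_gen .E32 x hx
    obtain ⟨z, hz, hxY⟩ := isWeight_gen31 x hx
    obtain ⟨z', hz', hyY⟩ := isWeight_gen31 y hy
    fin_cases i <;> simp only [frame, Matrix.cons_val, Fin.zero_eta, Fin.mk_one, Fin.reduceFinMk]
    · rw [mul_one]; exact hone _ (cartan_le_rightStable hx)
    · rw [hxF]; exact mul_mem_frameSpan hF (cartan_le_rightStable hy)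
    · rw [hxY]; exact mul_mem_frameSpan hY (cartan_le_rightStable hz)
    · rw [← mul_assoc, hxF, mul_assoc, hyY, ← mul_assoc]
      exact mul_mem_frameSpan hFY (cartan_le_rightStable hz')
  have bE : gen p q .E21 ∈ rightStable p q s m13 m23 m33 := gen_mem_rightStable (by simp)
  have bA : gen p q .E12 ∈ rightStable p q s m13 m23 m33 := gen_mem_rightStable (by simp)
  have bC : gen p q .E23 ∈ rightStable p q s m13 m23 m33 := gen_mem_rightStable (by simp)
  have hFF : gen p q .E32 * gen p q .E32 = 0 := e32_mul_e32
  cases g with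
  | H k => exact hcartan _ (H_mem_cartan k) i
  | expo c => exact hcartan _ (expo_mem_cartan c) i
  | E32 =>
    fin_cases i <;> simp only [frame, Matrix.cons_val, Fin.zero_eta, Fin.mk_one, Fin.reduceFinMk]
    · rwa [mul_one]
    · rw [hFF]; exact Submodule.zero_mem _
    · exact hFY
    · rw [← mul_assoc, hFF, zero_mul]; exact Submodule.zero_mem _
  | E21 =>
    fin_cases i <;> simp only [frame, Matrix.cons_val, Fin.zero_eta, Fin.mk_one, Fin.reduceFinMk]
    · rw [mul_one]; exact hone _ bE
    · rw [e21_mul_e32]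
      exact Submodule.sub_mem _ (Submodule.smul_mem _ _ (mul_mem_frameSpan hF bE)) hY
    · rw [e21_mul_e31]
      exact Submodule.smul_mem _ _ (mul_mem_frameSpan hY bE)
    -- Moving E21 past E32 creates a term in E31², the only place where its vanishing is needed.
    · rw [← mul_assoc, e21_mul_e32, sub_mul, e31_mul_e31 hp hgen, sub_zero, smul_mul_assoc,
        mul_assoc, e21_mul_e31, mul_smul_comm, ← mul_assoc]
      exact Submodule.smul_mem _ _ (Submodule.smul_mem _ _ (mul_mem_frameSpan hFY bE))
  | E12 =>
    obtain ⟨b, hb, hAY⟩ := exists_e12_mul_e31 (p := p) (q := q)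
    fin_cases i <;> simp only [frame, Matrix.cons_val, Fin.zero_eta, Fin.mk_one, Fin.reduceFinMk]
    · rw [mul_one]; exact hone _ bA
    · rw [e12_mul_e32]; exact mul_mem_frameSpan hF bA
    · rw [hAY]
      exact Submodule.add_mem _ (mul_mem_frameSpan hY bA)
        (mul_mem_frameSpan hF (cartan_le_rightStable hb))
    · rw [← mul_assoc, e12_mul_e32, mul_assoc, hAY, mul_add, ← mul_assoc, ← mul_assoc, hFF,
        zero_mul, add_zero]
      exact mul_mem_frameSpan hFY bA
  | E23 =>
    obtain ⟨b, hb, hCF⟩ := exists_e23_mul_e32 (p := p) (q := q)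
    have hCY := e23_mul_e31 hCF
    have hbB : b ∈ rightStable p q s m13 m23 m33 := cartan_le_rightStable hb
    fin_cases i <;> simp only [frame, Matrix.cons_val, Fin.zero_eta, Fin.mk_one, Fin.reduceFinMk]
    · rw [mul_one]; exact hone _ bC
    · rw [hCF]; exact Submodule.sub_mem _ (hone _ hbB) (mul_mem_frameSpan hF bC)
    · rw [hCY]
      exact Submodule.sub_mem _ (hone _ (Subalgebra.sub_mem _ (Subalgebra.smul_mem _
        (mul_mem hbB bE) _) (mul_mem bE hbB))) (mul_mem_frameSpan hY bC)
    · obtain ⟨z, hz, hbY⟩ := isWeight_gen31 b hb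
      rw [← mul_assoc, hCF, sub_mul, hbY, mul_assoc, hCY, mul_sub, ← mul_assoc _ (gen31 p q)]
      exact Submodule.sub_mem _ (mul_mem_frameSpan hY (cartan_le_rightStable hz))
        (Submodule.sub_mem _ (mul_mem_frameSpan hF (Subalgebra.sub_mem _ (Subalgebra.smul_mem _
          (mul_mem hbB bE) _) (mul_mem bE hbB))) (mul_mem_frameSpan hFY bC))

lemma frameMap_surjective (hp : p ≠ 0) (hgen : ∀ n : ℕ, 0 < n → (p * q) ^ n ≠ 1) :
    LinearMap.range (frameMap p q s m13 m23 m33) = ⊤ := by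
  have hst : ∀ g, ∀ x ∈ LinearMap.range (frameMap p q s m13 m23 m33),
      gen p q g • x ∈ LinearMap.range (frameMap p q s m13 m23 m33) := by
    rintro g _ ⟨f, rfl⟩
    rw [frameMap, LinearMap.sum_apply, Finset.smul_sum]
    refine Submodule.sum_mem _ fun i _ => ?_
    rw [LinearMap.comp_apply, smul_mkBilin]
    exact gen_mul_frame_mem hp hgen g i _
  rw [eq_top_iff]
  rintro x -
  obtain ⟨t, rfl⟩ := Submodule.mkQ_surjective _ x
  induction t using TensorProduct.induction_on with
  | zero => rw [map_zero]; exact Submodule.zero_mem _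
  | add x y hx hy => rw [map_add]; exact Submodule.add_mem _ hx hy
  | tmul u v =>
    have h := smul_mem_of_gen hst u _
      (frame_mem_frameSpan (p := p) (q := q) (s := s) (m33 := m33) 0 v)
    rw [smul_mkBilin, show u * frame p q 0 = u from mul_one u] at h
    exact h

lemma finiteDimensional_induced (hp : p ≠ 0) (hgen : ∀ n : ℕ, 0 < n → (p * q) ^ n ≠ 1)
    (hN : m13 - m23 = N) : FiniteDimensional ℂ (Induced p q s m13 m23 m33) := by
  have := finite_gz_zero hN
  exact Module.Finite.of_surjective _ (LinearMap.range_eq_top.1 (frameMap_surjective hp hgen))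

lemma finrank_induced_le (hp : p ≠ 0) (hgen : ∀ n : ℕ, 0 < n → (p * q) ^ n ≠ 1)
    (hN : m13 - m23 = N) : Module.finrank ℂ (Induced p q s m13 m23 m33) ≤ 4 * (N + 1) := by
  have := finite_gz_zero hN
  rw [← finrank_top, ← frameMap_surjective (s := s) (m33 := m33) hp hgen]
  refine (LinearMap.finrank_range_le _).trans ?_
  rw [Module.finrank_pi_fintype]
  simp [finrank_V0 hN]

variable {a1 a2 a3 : ℂ}

/-- Inside W the component V_0 carries exactly the inducing action, E23 included, because τ and ε do
not affect k = 0. Hence the map on the tensor product kills the induced relations. -/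
lemma redOp_emb_zero {τ ε : ℂ} {b : Gen} (hb : b ≠ .E32) (v : V0 m13 m23) :
    redOp p q s a1 a2 a3 τ ε m13 m23 m33 b (emb m13 m23 0 v) =
      emb m13 m23 0 (V0op s m13 m23 m33 b v) := by
  suffices h : (redOp p q s a1 a2 a3 τ ε m13 m23 m33 b).comp (emb m13 m23 0) =
      (emb m13 m23 0).comp (V0op s m13 m23 m33 b) from LinearMap.congr_fun h v
  refine Finsupp.lhom_ext' fun x => LinearMap.ext_ring ?_
  have h1 : redOp p q s a1 a2 a3 τ ε m13 m23 m33 b (emb m13 m23 0 (Finsupp.single x 1)) =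
      image p q s a1 a2 a3 τ ε m13 m23 m33 0 x.1 b := by
    rw [emb_single]; simp [redOp]
  have h2 : ∀ y : GZ m13 m23,
      V0op s m13 m23 m33 b (Finsupp.single y 1) = gzImage s m13 m23 m33 0 1 1 y.1 b := by
    intro y; simp [V0op]
  refine h1.trans (Eq.trans ?_ (congrArg (emb m13 m23 0) (h2 x).symm))
  cases b with
  | E32 => exact absurd rfl hb
  | E23 => exact (map_zero (emb m13 m23 0)).symm
  | _ => rfl

/-- The induced module is the module of the reduced basis. -/
lemma exists_equiv (hp : p ≠ 0) (hq : q ≠ 0) (hgen : ∀ n : ℕ, 0 < n → (p * q) ^ n ≠ 1)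
    (hs : ∀ x, s x ^ 2 = br p q x) (hN : m13 - m23 = N)
    (ha1 : a1 ≠ 0) (ha2 : a2 ≠ 0) (ha3 : a3 ≠ 0)
    {ρ : U p q →ₐ[ℂ] Module.End ℂ (W m13 m23)}
    (hρ : ∀ g, ρ (gen p q g) = redOp p q s a1 a2 a3 (q / p) 1 m13 m23 m33 g) :
    ∃ φ : Induced p q s m13 m23 m33 ≃ₗ[ℂ] W m13 m23,
      (∀ u x, φ (u • x) = ρ u (φ x)) ∧
        ∀ v, φ (Induced.mk p q s m13 m23 m33 1 v) = emb m13 m23 0 v := by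
  have := finiteDimensional_W hN
  have := finiteDimensional_induced (s := s) (m33 := m33) hp hgen hN
  let T : U p q ⊗[ℂ] V0 m13 m23 →ₗ[ℂ] W m13 m23 :=
    TensorProduct.lift (ρ.toLinearMap.compl₂ (emb m13 m23 0))
  have hT : ∀ u v, T (u ⊗ₜ v) = ρ u (emb m13 m23 0 v) := fun u v => rfl
  have hTs : ∀ (u : U p q) t, T (u • t) = ρ u (T t) := by
    intro u t
    induction t using TensorProduct.induction_on with
    | zero => simp
    | add x y hx hy => rw [smul_add, map_add, hx, hy, map_add, map_add]
    | tmul w v => rw [TensorProduct.smul_tmul', smul_eq_mul, hT, hT, map_mul]; rfl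
  -- The relations are a span over the algebra, so the kernel of T has to be presented as a
  -- submodule over it; equivariance `hTs` gives closure.
  have hker : inducedRel p q s m13 m23 m33 ≤
      { carrier := {t | T t = 0}
        add_mem' := fun {x y} hx hy => by
          simp only [Set.mem_ofPred_eq] at hx hy ⊢
          rw [map_add, hx, hy, add_zero]
        zero_mem' := map_zero T
        smul_mem' := fun u x hx => by
          simp only [Set.mem_ofPred_eq] at hx ⊢
          rw [hTs, hx, map_zero] } := by
    refine Submodule.span_le.2 ?_
    rintro _ ⟨u, b, v, hb, rfl⟩
    change T _ = 0
    rw [map_sub, hT, hT, map_mul, Module.End.mul_apply, hρ, redOp_emb_zero hb, sub_self]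
  let φ₀ : Induced p q s m13 m23 m33 →ₗ[ℂ] W m13 m23 :=
    (((inducedRel p q s m13 m23 m33).restrictScalars ℂ).liftQ T hker).comp
      (Submodule.Quotient.restrictScalarsEquiv ℂ _).symm.toLinearMap
  have hφ : ∀ t, φ₀ ((inducedRel p q s m13 m23 m33).mkQ t) = T t := fun t => rfl
  have hφs : ∀ (u : U p q) x, φ₀ (u • x) = ρ u (φ₀ x) := by
    intro u x
    obtain ⟨t, rfl⟩ := Submodule.mkQ_surjective _ x
    rw [← map_smul, hφ, hφ, hTs]
  have hφv : ∀ v, φ₀ (Induced.mk p q s m13 m23 m33 1 v) = emb m13 m23 0 v := by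
    intro v
    rw [Induced.mk, hφ, hT, map_one]; rfl
  have hsurj : LinearMap.range φ₀ = ⊤ := by
    refine eq_top_of_bv_zero_mem (τ := q / p) (ε := 1) (m33 := m33) hp hq hgen hs hN
      (div_ne_zero hq hp) ha1 ha2 ha3 ?_ (a := 0) (by simp [lo, hi])
      ⟨Induced.mk p q s m13 m23 m33 1 (gzVec m13 m23 (m13 - (0 : ℤ))), hφv _⟩
    rintro g _ ⟨x, rfl⟩
    exact ⟨gen p q g • x, by rw [hφs, hρ]⟩
  -- Spanning by four copies of V_0 bounds the dimension from above by that of W, and surjectivity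
  -- bounds it from below.
  have hfin : Module.finrank ℂ (Induced p q s m13 m23 m33) = Module.finrank ℂ (W m13 m23) := by
    refine le_antisymm ((finrank_induced_le hp hgen hN).trans (finrank_W hN).ge) ?_
    rw [← finrank_top ℂ (W m13 m23), ← hsurj]
    exact LinearMap.finrank_range_le _
  have hinj : Function.Injective φ₀ :=
    (LinearMap.injective_iff_surjective_of_finrank_eq_finrank hfin).2
      (LinearMap.range_eq_top.1 hsurj)
  exact ⟨LinearEquiv.ofBijective φ₀ ⟨hinj, LinearMap.range_eq_top.1 hsurj⟩, hφs, hφv⟩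

/-- Simplicity of a module in terms of the operators representing the generators. -/
lemma isSimpleModule_iff_irreducibleFamily {X Z : Type*} [AddCommGroup X] [Module ℂ X]
    [Module (U p q) X] [IsScalarTower ℂ (U p q) X] [AddCommGroup Z] [Module ℂ Z]
    {op : Gen → Z →ₗ[ℂ] Z} (φ : X ≃ₗ[ℂ] Z) (hφ : ∀ g x, φ (gen p q g • x) = op g (φ x)) :
    IsSimpleModule (U p q) X ↔ IrreducibleFamily op := by
  constructor
  · intro h
    have := IsSimpleModule.nontrivial (U p q) X
    refine ⟨φ.symm.toEquiv.nontrivial, fun S hS => ?_⟩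
    have hst : ∀ g, ∀ x ∈ S.comap φ.toLinearMap, gen p q g • x ∈ S.comap φ.toLinearMap := by
      intro g x hx
      change φ _ ∈ S
      rw [hφ]
      exact hS g _ hx
    let S' : Submodule (U p q) X :=
      { S.comap φ.toLinearMap with smul_mem' := fun u x hx => smul_mem_of_gen hst u x hx }
    have hmem : ∀ x, x ∈ S' ↔ φ x ∈ S := fun x => Iff.rfl
    rcases eq_bot_or_eq_top S' with h | h
    · left
      rw [eq_bot_iff]
      intro z hz
      have : φ.symm z ∈ S' := by rw [hmem, φ.apply_symm_apply]; exact hz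
      rw [h, Submodule.mem_bot] at this
      simpa using this
    · right
      rw [eq_top_iff]
      intro z _
      have : φ.symm z ∈ S' := by rw [h]; exact Submodule.mem_top
      rwa [hmem, φ.apply_symm_apply] at this
  · rintro ⟨hnt, hirr⟩
    have := φ.toEquiv.nontrivial
    refine isSimpleModule_iff _ _ |>.2 ⟨fun S => ?_⟩
    have hmem : ∀ z, z ∈ (S.restrictScalars ℂ).map φ.toLinearMap ↔ φ.symm z ∈ S := by
      intro z
      constructor
      · rintro ⟨x, hx, rfl⟩
        simpa using hx
      · intro h
        exact ⟨_, h, φ.apply_symm_apply z⟩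
    rcases hirr ((S.restrictScalars ℂ).map φ.toLinearMap) (by
      rintro g _ ⟨x, hx, rfl⟩
      exact ⟨gen p q g • x, S.smul_mem _ hx, hφ g x⟩) with h | h
    · left
      rw [eq_bot_iff]
      intro x hx
      have : φ x ∈ (S.restrictScalars ℂ).map φ.toLinearMap := ⟨x, hx, rfl⟩
      rw [h, Submodule.mem_bot] at this
      simpa using this
    · right
      rw [eq_top_iff]
      intro x _
      have : φ x ∈ (S.restrictScalars ℂ).map φ.toLinearMap := by rw [h]; exact Submodule.mem_top
      rw [hmem] at this
      simpa using this

end Induced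

end UpqGl21

end

/-! ### The induced module in the reduced basis and its irreducibility. -/

open UpqGl21 in
theorem proposition4 (p q : ℂ) (hp : p ≠ 0) (hq : q ≠ 0)
    (hgen : ∀ n : ℕ, 0 < n → (p * q) ^ n ≠ 1)
    (s : ℂ → ℂ) (hs : ∀ x, s x ^ 2 = br p q x)
    (m13 m23 m33 : ℂ) (hm : ∃ N : ℕ, m13 - m23 = N)
    (a1 a2 a3 : ℂ) (ha1 : a1 ≠ 0) (ha2 : a2 ≠ 0) (ha3 : a3 ≠ 0) :
    let l13 := m13 - 1
    let l23 := m23 - 2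
    let l33 := m33 - 1
    -- the explicit operators define a finite-dimensional representation ...
    FiniteDimensional ℂ (W m13 m23) ∧
    (∃ ρ : U p q →ₐ[ℂ] Module.End ℂ (W m13 m23),
      (∀ g, ρ (gen p q g) = redOp p q s a1 a2 a3 (q / p) 1 m13 m23 m33 g) ∧
      -- ... which is the induced module, written in the reduced basis
      ∃ φ : Induced p q s m13 m23 m33 ≃ₗ[ℂ] W m13 m23,
        (∀ u x, φ (u • x) = ρ u (φ x)) ∧
        ∀ v, φ (Induced.mk p q s m13 m23 m33 1 v) = emb m13 m23 0 v) ∧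
    -- the criterion for the induced module
    (IsSimpleModule (U p q) (Induced p q s m13 m23 m33) ↔
      br p q (l13 + l33 + 3) * br p q (l23 + l33 + 3) ≠ 0) ∧
    -- the criterion for the explicit operators without the factors q/p and the shift of L
    (IrreducibleFamily (redOp p q s a1 a2 a3 1 0 m13 m23 m33) ↔
      br p q (l13 + l33 + 3) * br p q (l23 + l33 + 3) ≠ 0) := by
  obtain ⟨N, hN⟩ := hm
  intro l13 l23 l33
  have e1 : l13 + l33 + 3 = m23 + m33 + N + 1 := by
    simp only [l13, l33]; linear_combination hN
  have e2 : l23 + l33 + 3 = m23 + m33 := by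
    simp only [l23, l33]; ring
  rw [e1, e2]
  obtain ⟨ρ, hρ⟩ := exists_rep (m33 := m33) hp hq hgen hs hN ha1 ha2 ha3
  obtain ⟨φ, hφ, hφv⟩ := exists_equiv hp hq hgen hs hN ha1 ha2 ha3 hρ
  refine ⟨finiteDimensional_W hN, ⟨ρ, hρ, φ, hφ, hφv⟩, ?_,
    irreducibleFamily_iff hp hq hgen hs hN one_ne_zero ha1 ha2 ha3⟩
  exact (isSimpleModule_iff_irreducibleFamily φ fun g x => by rw [hφ, hρ]).trans
    (irreducibleFamily_iff hp hq hgen hs hN (div_ne_zero hq hp) ha1 ha2 ha3)
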